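/- Let $p$ be an odd prime, let $e$ be a positive integer with $e\equiv 2\pmod 4$, let $q=p^e$, let $\mathrm{Tr}$ be the trace from $\mathbb{F}_q$ to $\mathbb{F}_p$, and let $\eta$ be the quadratic character of $\mathbb{F}_p$. Let $C_0$ and $C_1$ be the sets of squares and of nonsquares in $\mathbb{F}_p^*$, respectively. For $i\in\{0,1\}$ put $$D_i=\{x\in\mathbb{F}_q:\ \mathrm{Tr}(x^{p+1}-x)\in C_i\},\qquad \mathcal{C}_{D_i}=\{(\mathrm{Tr}(ax))_{x\in D_i}:\ a\in\mathbb{F}_q\}.$$ Let $i\in\{0,1\}$ satisfy $\left(\frac{e}{p}\right)=(-1)^i$ (Legendre symbol; in particular $p\nmid e$). Then $\mathcal{C}_{D_i}$ is a linear code over $\mathbb{F}_p$ of length $$|D_i|=\frac{p-1}{2}p^{e-1}-\frac{1+\eta(-1)p}{2}p^{\frac e2-1}$$ and dimension $e$, and it has at most $5$ nonzero weights. Its weight distribution is given by the following tables, in which the multiplicities of rows with the same weight are to be added (this happens for $p=3$) and rows with multiplicity $0$ are to be ignored. If $p\equiv 1\pmod 4$: $$\begin{array}{ll} \text{Weight}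 & \text{Multiplicity}\\ \hline 0 & 1\\ \frac{(p-1)^2}{2}p^{e-2} & p^{e-2}-1\\ \frac{(p-1)^2}{2}p^{e-2}-\frac{p+1}{2}p^{\frac e2-1} & \frac{p^2-1}{2}p^{e-2}-(p-1)p^{\frac e2-1}\\ \frac{(p-1)^2}{2}p^{e-2}-\frac{p+3}{2}p^{\frac e2-1} & \frac{(p-1)(p-3)}{4}p^{e-2}-\frac{(p-1)(p-3)}{4}p^{\frac e2-1}\\ \frac{(p-1)^2}{2}p^{e-2}-\frac{p-1}{2}p^{\frac e2-1} & \frac{p^2-1}{4}p^{e-2}+\frac{p^2-1}{4}p^{\frac e2-1}\\ \frac{(p-1)^2}{2}p^{e-2}-p^{\frac e2-1} & (p-1)p^{e-2} \end{array}$$ If $p\equiv 3\pmod 4$: $$\begin{array}{ll} \text{Weight} & \text{Multiplicity}\\ \hline 0 & 1\\ \frac{(p-1)^2}{2}p^{e-2} & p^{e-1}-1\\ \frac{(p-1)^2}{2}p^{e-2}+\frac{p-1}{2}p^{\frac e2-1} & \frac{p^2-1}{2}p^{e-2}\\ \frac{(p-1)^2}{2}p^{e-2}+\frac{p-3}{2}p^{\frac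 e2-1} & \frac{(p-1)^2}{4}p^{e-2}-\frac{(p-1)^2}{4}p^{\frac e2-1}\\ \frac{(p-1)^2}{2}p^{e-2}+\frac{p+1}{2}p^{\frac e2-1} & \frac{(p-1)^2}{4}p^{e-2}+\frac{(p-1)^2}{4}p^{\frac e2-1} \end{array}$$ -/

import Mathlib

/-- The cyclotomic classes of order two of `ZMod p`: the nonzero squares for `i = 0`,
the nonsquares for `i = 1`. -/
def cyclotomicClassTwo (p : ℕ) (i : Fin 2) : Set (ZMod p) :=
  {c | c ≠ 0 ∧ (IsSquare c ↔ i = 0)}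

open Classical in
/-- The set of all `x` in `F` for which `Tr (x ^ (p + 1) - x)` lies in the `i`-th cyclotomic
class, where `Tr` is the absolute trace. -/
noncomputable def definingSet (p : ℕ) (F : Type*) [Field F] [Fintype F] [Algebra (ZMod p) F]
    (i : Fin 2) : Finset F :=
  Finset.univ.filter
    (fun x : F => Algebra.trace (ZMod p) F (x ^ (p + 1) - x) ∈ cyclotomicClassTwo p i)

/-- The linear code over `ZMod p` with defining set `D`: its codewords are the vectors
`(Tr (a * d))`, indexed by `d ∈ D`, for `a` in `F`. -/
noncomputable def traceCode (p : ℕ) {F : Type*} [Field F] [Algebra (ZMod p) F] (D : Finset F) :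
    Submodule (ZMod p) (D → ZMod p) where
  carrier := {c | ∃ a : F, c = fun d : D => Algebra.trace (ZMod p) F (a * d)}
  add_mem' := by
    rintro _ _ ⟨a, rfl⟩ ⟨b, rfl⟩
    exact ⟨a + b, by ext d; simp [add_mul]⟩
  zero_mem' := ⟨0, by ext d; simp⟩
  smul_mem' := by
    rintro r _ ⟨a, rfl⟩
    exact ⟨r • a, by ext d; simp⟩

/-- The number of codewords of Hamming weight `w` in a linear code `C`. -/
noncomputable def weightCount {p : ℕ} {ι : Type*} [Fintype ι]
    (C : Submodule (ZMod p) (ι → ZMod p)) (w : ℕ) : ℕ :=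
  Set.ncard {c : ι → ZMod p | c ∈ C ∧ hammingNorm c = w}

/-- A table of pairs (weight, multiplicity) lists the weight distribution of `C`: for each `w`,
the number of codewords of weight `w` is the sum of the multiplicities of the rows of weight `w`
(so it is `0` if there is no such row). -/
def HasWeightTable {p : ℕ} {ι : Type*} [Fintype ι]
    (C : Submodule (ZMod p) (ι → ZMod p)) (T : List (ℚ × ℚ)) : Prop :=
  ∀ w : ℕ, (weightCount C w : ℚ) = ((T.filter (fun r => r.1 = (w : ℚ))).map Prod.snd).sum

/-- The weight table for `p` congruent to `1` modulo `4`. -/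
def tableOneModFour (p e : ℕ) : List (ℚ × ℚ) :=
  let P : ℚ := (p : ℚ) ^ (e - 2)
  let Q : ℚ := (p : ℚ) ^ (e / 2 - 1)
  let W : ℚ := ((p : ℚ) - 1) ^ 2 / 2 * P
  [ (0, 1),
    (W, P - 1),
    (W - ((p : ℚ) + 1) / 2 * Q, ((p : ℚ) ^ 2 - 1) / 2 * P - ((p : ℚ) - 1) * Q),
    (W - ((p : ℚ) + 3) / 2 * Q,
      ((p : ℚ) - 1) * ((p : ℚ) - 3) / 4 * P - ((p : ℚ) - 1) * ((p : ℚ) - 3) / 4 * Q),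
    (W - ((p : ℚ) - 1) / 2 * Q, ((p : ℚ) ^ 2 - 1) / 4 * P + ((p : ℚ) ^ 2 - 1) / 4 * Q),
    (W - Q, ((p : ℚ) - 1) * P) ]

/-- The weight table for `p` congruent to `3` modulo `4`. -/
def tableThreeModFour (p e : ℕ) : List (ℚ × ℚ) :=
  let P : ℚ := (p : ℚ) ^ (e - 2)
  let Q : ℚ := (p : ℚ) ^ (e / 2 - 1)
  let W : ℚ := ((p : ℚ) - 1) ^ 2 / 2 * P
  [ (0, 1),
    (W, (p : ℚ) ^ (e - 1) - 1),
    (W + ((p : ℚ) - 1) / 2 * Q, ((p : ℚ) ^ 2 - 1) / 2 * P),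
    (W + ((p : ℚ) - 3) / 2 * Q, ((p : ℚ) - 1) ^ 2 / 4 * P - ((p : ℚ) - 1) ^ 2 / 4 * Q),
    (W + ((p : ℚ) + 1) / 2 * Q, ((p : ℚ) - 1) ^ 2 / 4 * P + ((p : ℚ) - 1) ^ 2 / 4 * Q) ]

/-! Write e = 2m with m odd, E for the residue of e mod p, and Q(x) = Tr(x^(p+1)), a quadratic form
over the prime field. Translating x = y + 1/2 turns Tr(x^(p+1) - x) into Q(y) - E/4. The polar form
satisfies B(y, w^p) = Tr((w^(p²) + w) y), and w ↦ w^(p²) + w is bijective because m is odd. So Q is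
nondegenerate, and code words can be indexed by w instead of a = w^(p²) + w.

Every nonzero element of the prime field is a (p+1)-th power in F, so Q takes all nonzero values
equally often; the excess S of the value 0 satisfies S² = |F| (`sq_excess_eq_card`). Since S ≡ 1 and
p^m ≡ -1 mod p+1, the sign is forced: S = -p^m (`card_traceNormForm_eq`). Completing the square then
gives the number of y with Q(y) = c and B(y, v) = t in terms of the number of roots g of Q(v)g² + tg
+ c (`card_mul_card_eq_and_polar_eq`).

Summed over c in the class of E, this reduces the zero coordinates of the code word of w ≠ 0 to
counting the g at which -(Q(w)g² - Tr(w)g + E/4) has the quadratic character of E. The substitution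
u = E/g - 2Tr(w) makes that a count for u² + 4(E·Q(w) - Tr(w)²)
(`card_quadraticChar_neg_quadratic`). Hence for fixed p and m the weight depends only on the
characters σ of E·Q(w) - Tr(w)² and τ of E·Q(w). Since Tr = B(·, 1/2), the same joint distribution
counts the w with given (σ, τ) (`card_quadraticChar_traceNormForm`). All weights with w ≠ 0 are
positive, so the encoding is injective and the dimension is e. -/

/-! ### Level sets of a nondegenerate quadratic form over a finite field. -/

section QuadraticFormCounts

open Finset

variable {K V : Type*} [Field K] [Fintype K] [DecidableEq K] [AddCommGroup V] [Module K V]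
  [Fintype V]

/-- The fibres of a nonzero linear functional all have the same size. -/
theorem card_mul_card_fiber_linearFunctional (l : V →ₗ[K] K) (hl : l ≠ 0) (t : K) :
    Fintype.card K * #{y : V | l y = t} = Fintype.card V := by
  have hs : Function.Surjective l := LinearMap.surjective hl
  have h : ∀ t : K, #{y : V | l y = t} = #{y : V | l y = 0} := by
    intro t
    obtain ⟨x, rfl⟩ := hs t
    refine card_bij (fun y _ => y - x) ?_ ?_ ?_
    · intro y hy; simp at hy ⊢; rw [hy, sub_self]
    · intro y _ z _ h; simpa using h
    · intro y hy; refine ⟨y + x, ?_, by simp⟩; simp at hy ⊢; exact hy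
  have h2 := card_eq_sum_card_fiberwise (s := (univ : Finset V)) (t := (univ : Finset K))
    (f := l) (fun _ _ => mem_coe.2 (mem_univ _))
  rw [Finset.sum_congr rfl (fun t _ => h t), sum_const, smul_eq_mul, card_univ, card_univ] at h2
  rw [h t, h2]

namespace QuadraticMap

variable (Q : QuadraticForm K V)

/-- For a nondegenerate form, the level sets of a polar functional have the expected size. -/
theorem card_mul_card_polar_eq (hQ : ∀ v, (∀ y, polar Q y v = 0) → v = 0) {v : V} (hv : v ≠ 0)
    (t : K) : Fintype.card K * #{y : V | polar Q y v = t} = Fintype.card V := by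
  have := card_mul_card_fiber_linearFunctional ((polarBilin Q).flip v) (fun h => hv <| hQ v fun y => by
    simpa using DFunLike.congr_fun h y) t
  simpa using this

omit [Fintype K] [DecidableEq K] [Fintype V] in
theorem map_add_polar (x y : V) : Q (x + y) = Q x + Q y + polar Q x y := by
  simp [polar]

omit [Fintype K] in
/-- Completing the square: adding a linear term permutes the level sets. -/
theorem card_add_polar_eq (w : V) (c : K) :
    #{y : V | Q y + polar Q y w = c} = #{y : V | Q y = c + Q w} := by
  refine card_bij (fun y _ => y + w) ?_ ?_ ?_
  · intro y hy; simp only [mem_filter, mem_univ, true_and] at hy ⊢; rw [map_add_polar, ← hy]; ring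
  · intro y _ z _ h; simpa using h
  · intro y hy
    refine ⟨y - w, ?_, by simp⟩
    simp only [mem_filter, mem_univ, true_and] at hy ⊢
    have := map_add_polar Q (y - w) w
    rw [sub_add_cancel, hy] at this
    linear_combination -this

theorem card_eq_of_card_level {N S : ℤ}
    (hN : ∀ c, (#{x : V | Q x = c} : ℤ) = N + if c = 0 then S else 0) :
    (Fintype.card V : ℤ) = Fintype.card K * N + S := by
  have h2 := card_eq_sum_card_fiberwise (s := (univ : Finset V)) (t := (univ : Finset K))
    (f := Q) (fun _ _ => mem_coe.2 (mem_univ _))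
  have h3 : (Fintype.card V : ℤ) = ∑ c : K, (#{x : V | Q x = c} : ℤ) := by
    rw [← card_univ]; exact_mod_cast h2
  rw [h3, Finset.sum_congr rfl (fun c _ => hN c), sum_add_distrib]
  simp

/-- If all nonzero values of a nondegenerate form are taken equally often, then the excess of
the zero value squares to the order of the space. -/
theorem sq_excess_eq_card (hQ : ∀ v, (∀ y, polar Q y v = 0) → v = 0) {N S : ℤ}
    (hN : ∀ c, (#{x : V | Q x = c} : ℤ) = N + if c = 0 then S else 0) :
    S ^ 2 = Fintype.card V := by
  set k : ℤ := (Fintype.card K : ℤ) with hk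
  set q : ℤ := (Fintype.card V : ℤ) with hq
  have hk1 : 1 < k := by
    rw [hk]; exact_mod_cast Fintype.one_lt_card (α := K)
  have hsum : q = k * N + S := card_eq_of_card_level Q hN
  -- count the pairs `(y, z)` with `Q (y + z) = Q y` in two ways
  have hA : ∑ y : V, (#{x : V | Q x = Q y} : ℤ) = k * N ^ 2 + 2 * S * N + S ^ 2 := by
    have h1 : ∑ y : V, (#{x : V | Q x = Q y} : ℤ)
        = ∑ y : V, (N + if Q y = 0 then S else 0) := Finset.sum_congr rfl (fun y _ => hN _)
    have h0 := hN 0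
    rw [if_pos rfl] at h0
    rw [h1, sum_add_distrib, ← sum_filter, sum_const, sum_const, card_univ, nsmul_eq_mul,
      nsmul_eq_mul, h0, ← hq, hsum]
    ring
  have hB : ∑ y : V, (#{x : V | Q x = Q y} : ℤ) = ∑ z : V, (#{y : V | Q z + polar Q y z = 0} : ℤ) := by
    have : ∀ y : V, #{x : V | Q x = Q y} = #{z : V | Q z + polar Q y z = 0} := by
      intro y
      refine card_bij (fun x _ => x - y) ?_ ?_ ?_
      · intro x hx
        simp only [mem_filter, mem_univ, true_and] at hx ⊢
        have := map_add_polar Q y (x - y)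
        rw [add_sub_cancel, hx] at this
        linear_combination -this
      · intro x _ z _ h; simpa using h
      · intro z hz
        refine ⟨y + z, ?_, by simp⟩
        simp only [mem_filter, mem_univ, true_and] at hz ⊢
        rw [map_add_polar]; linear_combination hz
    simp_rw [this, card_filter]
    push_cast
    rw [sum_comm]
  -- For z = 0 every y counts; for each other z the condition is a fibre of a nonzero functional, of
  -- size q / k.
  have hC : k * ∑ z : V, (#{y : V | Q z + polar Q y z = 0} : ℤ) = k * q + (q - 1) * q := by
    classical
    rw [← add_sum_erase _ _ (mem_univ (0 : V)), mul_add, mul_sum]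
    have : ∀ z ∈ univ.erase (0 : V), k * (#{y : V | Q z + polar Q y z = 0} : ℤ) = q := by
      intro z hz
      have := card_mul_card_polar_eq Q hQ (ne_of_mem_erase hz) (-Q z)
      rw [hk, hq, ← this]
      push_cast
      congr 3
      ext y
      simp only [mem_filter, mem_univ, true_and]
      constructor <;> intro h <;> linear_combination h
    rw [Finset.sum_congr rfl this, sum_const, card_erase_of_mem (mem_univ _), card_univ,
      nsmul_eq_mul, Nat.cast_sub Fintype.card_pos, ← hq]
    simp [hq]
  rw [← hB, hA] at hC
  have : (k - 1) * (S ^ 2 - q) = 0 := by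
    rw [hsum] at hC ⊢
    linear_combination hC
  rcases mul_eq_zero.1 this with h | h <;> linarith

/-- The joint distribution of a form and of a polar functional. -/
theorem card_mul_card_eq_and_polar_eq (hQ : ∀ v, (∀ y, polar Q y v = 0) → v = 0) {N S h : ℤ}
    (hN : ∀ c, (#{x : V | Q x = c} : ℤ) = N + if c = 0 then S else 0)
    (hV : (Fintype.card V : ℤ) = Fintype.card K * h) {v : V} (hv : v ≠ 0) (c t : K) :
    Fintype.card K * (#{y : V | Q y = c ∧ polar Q y v = t} : ℤ)
      = h + S * (#{g : K | Q v * g ^ 2 + t * g + c = 0} - 1) := by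
  set k : ℤ := (Fintype.card K : ℤ) with hk
  set q : ℤ := (Fintype.card V : ℤ) with hq
  have hk1 : 1 < k := by
    rw [hk]; exact_mod_cast Fintype.one_lt_card (α := K)
  have hsum : q = k * N + S := card_eq_of_card_level Q hN
  -- The pairs (g, y) with Q(y) + g(B(y, v) - t) = c are counted in two ways. For fixed g,
  -- completing the square with `g • v` gives a level set of Q.
  have h1 : ∀ g : K, (#{y : V | Q y + g * (polar Q y v - t) = c} : ℤ)
      = N + if Q v * g ^ 2 + t * g + c = 0 then S else 0 := by
    intro g
    have := card_add_polar_eq Q (g • v) (c + g * t)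
    have e1 : ({y : V | Q y + g * (polar Q y v - t) = c} : Finset V)
        = ({y : V | Q y + polar Q y (g • v) = c + g * t} : Finset V) := by
      ext y
      simp only [mem_filter, mem_univ, true_and, polar_smul_right, smul_eq_mul]
      constructor <;> intro h <;> linear_combination h
    rw [e1, this, hN, QuadraticMap.map_smul]
    have : c + g * t + (g * g) • Q v = Q v * g ^ 2 + t * g + c := by simp; ring
    rw [this]
  have h2 : ∑ g : K, (#{y : V | Q y + g * (polar Q y v - t) = c} : ℤ)
      = k * N + S * #{g : K | Q v * g ^ 2 + t * g + c = 0} := by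
    rw [Finset.sum_congr rfl (fun g _ => h1 g), sum_add_distrib, ← sum_filter, sum_const, sum_const,
      card_univ, nsmul_eq_mul, nsmul_eq_mul]
    ring
  -- For fixed y the equation is affine in g: one solution if B(y, v) ≠ t, otherwise all of K or
  -- none according to whether Q(y) = c.
  have h3 : ∀ y : V, (#{g : K | Q y + g * (polar Q y v - t) = c} : ℤ)
      = 1 - (if polar Q y v = t then 1 else 0)
        + k * (if Q y = c ∧ polar Q y v = t then 1 else 0) := by
    intro y
    by_cases hy : polar Q y v = t
    · by_cases hc : Q y = c
      · simp [hy, hc, hk]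
      · simp [hy, hc]
    · have hy' : polar Q y v - t ≠ 0 := sub_ne_zero.2 hy
      have : ({g : K | Q y + g * (polar Q y v - t) = c} : Finset K)
          = {(c - Q y) / (polar Q y v - t)} := by
        ext g
        simp only [mem_filter, mem_univ, true_and, mem_singleton]
        rw [eq_div_iff hy']
        constructor <;> intro h <;> linear_combination h
      simp [this, hy]
  have h4 : ∑ g : K, (#{y : V | Q y + g * (polar Q y v - t) = c} : ℤ)
      = q - #{y : V | polar Q y v = t} + k * #{y : V | Q y = c ∧ polar Q y v = t} := by
    have : ∑ g : K, (#{y : V | Q y + g * (polar Q y v - t) = c} : ℤ)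
        = ∑ y : V, (#{g : K | Q y + g * (polar Q y v - t) = c} : ℤ) := by
      simp_rw [card_filter]
      push_cast
      rw [sum_comm]
    rw [this, Finset.sum_congr rfl (fun y _ => h3 y), sum_add_distrib, sum_sub_distrib, ← mul_sum]
    simp [hq]
  have h5 : k * (#{y : V | polar Q y v = t} : ℤ) = q := by
    rw [hk, hq]; exact_mod_cast card_mul_card_polar_eq Q hQ hv t
  have h6 : (#{y : V | polar Q y v = t} : ℤ) = h :=
    mul_left_cancel₀ (by linarith : k ≠ 0) (h5.trans hV)
  rw [h6, h2] at h4
  linear_combination -h4 - hsum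

end QuadraticMap

end QuadraticFormCounts

/-! ### Quadratic character counts for quadratic polynomials over a finite field. -/

section QuadraticCharCounts

open Finset

variable {K : Type*} [Field K] [Fintype K] [DecidableEq K]

local notation "χ" => quadraticChar K

theorem card_filter_sq_eq (hK : ringChar K ≠ 2) (a : K) :
    (#{x : K | x ^ 2 = a} : ℤ) = χ a + 1 := by
  rw [← quadraticChar_card_sqrts hK a]
  congr 2
  ext x
  simp

/-- The number of roots of a quadratic polynomial in terms of its discriminant. -/
theorem card_filter_quadratic_eq_zero (hK : ringChar K ≠ 2) {a : K} (ha : a ≠ 0) (b c : K) :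
    (#{g : K | a * g ^ 2 + b * g + c = 0} : ℤ) = χ (b ^ 2 - 4 * a * c) + 1 := by
  have h2 : (2 : K) ≠ 0 := Ring.two_ne_zero hK
  rw [← card_filter_sq_eq hK]
  norm_cast
  refine card_bij (fun g _ => 2 * a * g + b) ?_ ?_ ?_
  · intro g hg
    simp only [mem_filter, mem_univ, true_and] at hg ⊢
    linear_combination 4 * a * hg
  · intro g _ g' _ h
    have : 2 * a * (g - g') = 0 := by linear_combination h
    simpa [h2, ha, sub_eq_zero] using this
  · intro u hu
    simp only [mem_filter, mem_univ, true_and] at hu ⊢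
    refine ⟨(u - b) / (2 * a), ?_, by field_simp; ring⟩
    have : 4 * a * (a * ((u - b) / (2 * a)) ^ 2 + b * ((u - b) / (2 * a)) + c) = 0 := by
      field_simp
      linear_combination 4 * hu
    have h4 : (4 : K) ≠ 0 := by
      have : (4 : K) = 2 * 2 := by norm_num
      rw [this]; exact mul_ne_zero h2 h2
    simpa [h4, ha] using this

/-- The sum counts points on the hyperbola w² - u² = D, which a = w - u, w + u = D/a parametrizes by
the nonzero elements of K. -/
theorem sum_quadraticChar_sq_add (hK : ringChar K ≠ 2) {D : K} (hD : D ≠ 0) :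
    ∑ u : K, χ (u ^ 2 + D) = -1 := by
  have h2 : (2 : K) ≠ 0 := Ring.two_ne_zero hK
  have h : ∑ u : K, (χ (u ^ 2 + D) + 1) = Fintype.card K - 1 := by
    simp_rw [← card_filter_sq_eq hK]
    have e : #((univ : Finset K).sigma fun u => ({w : K | w ^ 2 = u ^ 2 + D} : Finset K))
        = #((univ : Finset K).erase 0) := by
      refine card_bij' (fun x _ => x.2 - x.1) (fun a _ => ⟨(D / a - a) / 2, (D / a + a) / 2⟩)
        ?_ ?_ ?_ ?_
      · rintro ⟨u, w⟩ h
        simp only [mem_sigma, mem_univ, mem_filter, true_and, mem_erase, and_true] at h ⊢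
        intro h0
        apply hD
        linear_combination (w + u) * h0 - h
      · intro a ha
        simp only [mem_sigma, mem_univ, mem_filter, true_and, mem_erase, and_true] at ha ⊢
        field_simp
        ring
      · rintro ⟨u, w⟩ h
        simp only [mem_sigma, mem_univ, mem_filter, true_and] at h
        have h0 : w - u ≠ 0 := by
          intro h0
          apply hD
          linear_combination (w + u) * h0 - h
        have hd : D / (w - u) = w + u := by
          rw [div_eq_iff h0]; linear_combination -h
        simp only [hd, Sigma.mk.injEq, heq_eq_eq]
        constructor <;> field_simp <;> ring
      · intro a ha
        simp only
        have ha' : a ≠ 0 := ne_of_mem_erase ha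
        field_simp
        ring
    rw [card_sigma, card_erase_of_mem (mem_univ _), card_univ] at e
    have hc : 1 ≤ Fintype.card K := Fintype.card_pos
    zify [hc] at e
    exact e
  rw [sum_add_distrib, sum_const, card_univ, nsmul_eq_mul, mul_one] at h
  linarith

theorem quadraticChar_values (a : K) : χ a = 0 ∨ χ a = 1 ∨ χ a = -1 := by
  by_cases ha : a = 0
  · left; simp [ha]
  · right; exact quadraticChar_dichotomy ha

/-- The number of arguments at which `u ^ 2 + D` is a nonzero square, respectively a nonsquare. -/
theorem two_mul_card_quadraticChar_sq_add (hK : ringChar K ≠ 2) {D : K} (hD : D ≠ 0) {σ : ℤ}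
    (hσ : σ = 1 ∨ σ = -1) :
    2 * (#{u : K | χ (u ^ 2 + D) = σ} : ℤ) = Fintype.card K - 1 - χ (-D) - σ := by
  -- For σ = ±1 and a character value x in {0, 1, -1}, twice the indicator of x = σ is 1 - [x = 0] +
  -- σx.
  have h1 : ∀ u : K, 2 * (if χ (u ^ 2 + D) = σ then (1 : ℤ) else 0)
      = 1 - (if u ^ 2 = -D then 1 else 0) + σ * χ (u ^ 2 + D) := by
    intro u
    by_cases h0 : u ^ 2 = -D
    · have : u ^ 2 + D = 0 := by rw [h0]; ring
      rcases hσ with rfl | rfl <;> simp [h0]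
    · have : u ^ 2 + D ≠ 0 := fun h => h0 (by linear_combination h)
      rcases hσ with rfl | rfl <;> rcases quadraticChar_dichotomy this with h | h <;> simp [h, h0]
  have h2 : 2 * (#{u : K | χ (u ^ 2 + D) = σ} : ℤ)
      = ∑ u : K, 2 * (if χ (u ^ 2 + D) = σ then (1 : ℤ) else 0) := by
    rw [card_filter, ← mul_sum]; push_cast; rfl
  rw [h2, Finset.sum_congr rfl (fun u _ => h1 u), sum_add_distrib, sum_sub_distrib, ← mul_sum,
    sum_quadraticChar_sq_add hK hD]
  have h3 : ∑ u : K, (if u ^ 2 = -D then (1 : ℤ) else 0) = χ (-D) + 1 := by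
    rw [← card_filter_sq_eq hK, card_filter]; push_cast; rfl
  rw [h3]
  simp
  ring

theorem card_quadraticChar_sq_eq (σ : ℤ) (hσ : σ = 1 ∨ σ = -1) :
    (#{u : K | χ (u ^ 2) = σ} : ℤ) = if σ = 1 then (Fintype.card K : ℤ) - 1 else 0 := by
  have h : ∀ u : K, χ (u ^ 2) = if u = 0 then 0 else 1 := by
    intro u
    split_ifs with hu
    · simp [hu]
    · exact quadraticChar_sq_one' hu
  rcases hσ with rfl | rfl
  · have : ({u : K | χ (u ^ 2) = 1} : Finset K) = univ.erase 0 := by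
      ext u; simp only [mem_filter, mem_univ, true_and, mem_erase, h, and_true]
      split_ifs with hu <;> simp [hu]
    have hc : 1 ≤ Fintype.card K := Fintype.card_pos
    rw [this, card_erase_of_mem (mem_univ _), card_univ]
    simp [hc]
  · have : ({u : K | χ (u ^ 2) = -1} : Finset K) = ∅ := by
      ext u; simp only [mem_filter, mem_univ, true_and, h]
      split_ifs with hu <;> simp
    rw [this]; simp

theorem two_mul_card_quadraticChar_eq (hK : ringChar K ≠ 2) {τ : ℤ} (hτ : τ = 1 ∨ τ = -1) :
    2 * (#{a : K | χ a = τ} : ℤ) = Fintype.card K - 1 := by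
  have h1 : ∀ u : K, 2 * (if χ u = τ then (1 : ℤ) else 0)
      = 1 - (if u = 0 then 1 else 0) + τ * χ u := by
    intro u
    by_cases h0 : u = 0
    · rcases hτ with rfl | rfl <;> simp [h0]
    · rcases hτ with rfl | rfl <;> rcases quadraticChar_dichotomy h0 with h | h <;> simp [h, h0]
  have h2 : 2 * (#{u : K | χ u = τ} : ℤ) = ∑ u : K, 2 * (if χ u = τ then (1 : ℤ) else 0) := by
    rw [card_filter, ← mul_sum]; push_cast; rfl
  rw [h2, Finset.sum_congr rfl (fun u _ => h1 u), sum_add_distrib, sum_sub_distrib, ← mul_sum,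
    quadraticChar_sum_zero hK]
  simp

theorem quadraticChar_four (hK : ringChar K ≠ 2) : χ 4 = 1 := by
  have : (4 : K) = 2 ^ 2 := by norm_num
  rw [this]; exact quadraticChar_sq_one' (Ring.two_ne_zero hK)

/-- Reduction of the number of values of a prescribed quadratic character of the polynomial
`A * g ^ 2 - s * g + E / 4` to the case of a pure quadratic. -/
theorem card_quadraticChar_neg_quadratic (hK : ringChar K ≠ 2) {E : K} (hE : E ≠ 0) (A s : K) :
    (#{g : K | χ (-(A * g ^ 2 - s * g + E / 4)) = χ E} : ℤ)
      = (if χ (-1) = 1 then 1 else 0) + #{u : K | χ (u ^ 2 + 4 * (E * A - s ^ 2)) = χ (-1)}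
        - (if χ (E * A) = χ (-1) then 1 else 0) := by
  have h2 : (2 : K) ≠ 0 := Ring.two_ne_zero hK
  have h4 : (4 : K) ≠ 0 := by
    have : (4 : K) = 2 * 2 := by norm_num
    rw [this]; exact mul_ne_zero h2 h2
  have key : ∀ g : K, χ (-(A * g ^ 2 - s * g + E / 4)) = χ E ↔
      χ (4 * E * (A * g ^ 2 - s * g + E / 4)) = χ (-1) := by
    intro g
    rw [neg_eq_neg_one_mul, map_mul, mul_assoc, map_mul χ 4, quadraticChar_four hK, one_mul,
      map_mul]
    have hm : (-1 : K) ≠ 0 := by simp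
    rcases quadraticChar_dichotomy hm with h | h <;> rcases quadraticChar_dichotomy hE with h' | h'
      <;> simp [h, h', neg_eq_iff_eq_neg]
  -- The substitution u = E/g - 2s is a bijection from g ≠ 0 onto u ≠ -2s, and the two values differ
  -- by the square factor g². The omitted points g = 0 and u = -2s produce the two correction terms.
  have e1 : #(({g : K | χ (-(A * g ^ 2 - s * g + E / 4)) = χ E} : Finset K).erase 0)
      = #(({u : K | χ (u ^ 2 + 4 * (E * A - s ^ 2)) = χ (-1)} : Finset K).erase (-2 * s)) := by
    have id : ∀ g : K, g ≠ 0 → 4 * E * (A * g ^ 2 - s * g + E / 4)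
        = ((E / g - 2 * s) ^ 2 + 4 * (E * A - s ^ 2)) * g ^ 2 := by
      intro g hg; field_simp; ring
    have id2 : ∀ g : K, g ≠ 0 → χ (4 * E * (A * g ^ 2 - s * g + E / 4))
        = χ ((E / g - 2 * s) ^ 2 + 4 * (E * A - s ^ 2)) := by
      intro g hg
      rw [id g hg, map_mul, quadraticChar_sq_one' hg, mul_one]
    refine card_bij' (fun g _ => E / g - 2 * s) (fun u _ => E / (u + 2 * s)) ?_ ?_ ?_ ?_
    · intro g hg
      simp only [mem_erase, mem_filter, mem_univ, true_and] at hg ⊢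
      rw [key, id2 g hg.1] at hg
      refine ⟨fun h => ?_, hg.2⟩
      have : E / g = 0 := by linear_combination h
      simp [hE, hg.1] at this
    · intro u hu
      simp only [mem_erase, mem_filter, mem_univ, true_and] at hu ⊢
      have h0 : u + 2 * s ≠ 0 := fun h => hu.1 (by linear_combination h)
      have hg : E / (u + 2 * s) ≠ 0 := div_ne_zero hE h0
      refine ⟨hg, ?_⟩
      rw [key, id2 _ hg, div_div_cancel₀ hE, add_sub_cancel_right]
      exact hu.2
    · intro g hg
      simp only [mem_erase, mem_filter, mem_univ, true_and] at hg
      have := hg.1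
      rw [sub_add_cancel, div_div_cancel₀ hE]
    · intro u hu
      simp only [mem_erase, mem_filter, mem_univ, true_and] at hu ⊢
      have h0 : u + 2 * s ≠ 0 := fun h => hu.1 (by linear_combination h)
      rw [div_div_cancel₀ hE, add_sub_cancel_right]
  have e2 : ∀ (T : Finset K) (x : K), (#T : ℤ) = #(T.erase x) + if x ∈ T then 1 else 0 := by
    intro T x
    split_ifs with h
    · exact_mod_cast (card_erase_add_one h).symm
    · rw [erase_eq_of_notMem h]; simp
  rw [e2 _ 0, e1, e2 ({u : K | χ (u ^ 2 + 4 * (E * A - s ^ 2)) = χ (-1)} : Finset K) (-2 * s)]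
  have c1 : (0 : K) ∈ ({g : K | χ (-(A * g ^ 2 - s * g + E / 4)) = χ E} : Finset K)
      ↔ χ (-1) = 1 := by
    simp only [mem_filter, mem_univ, true_and]
    rw [key]
    have : 4 * E * (A * 0 ^ 2 - s * 0 + E / 4) = E ^ 2 := by field_simp; ring
    rw [this, quadraticChar_sq_one' hE, eq_comm]
  have c2 : (-2 * s) ∈ ({u : K | χ (u ^ 2 + 4 * (E * A - s ^ 2)) = χ (-1)} : Finset K)
      ↔ χ (E * A) = χ (-1) := by
    simp only [mem_filter, mem_univ, true_and]
    have : (-2 * s) ^ 2 + 4 * (E * A - s ^ 2) = 4 * (E * A) := by ring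
    rw [this, map_mul χ 4, quadraticChar_four hK, one_mul]
  simp only [c1, c2]
  ring

theorem quadraticChar_sub_sq_eq_iff (a s : K) (σ : ℤ) :
    χ (a - s ^ 2) = σ ↔ χ (s ^ 2 + -a) = χ (-1) * σ := by
  have hm : (-1 : K) ≠ 0 := by simp
  have : a - s ^ 2 = -1 * (s ^ 2 + -a) := by ring
  rw [this, map_mul]
  rcases quadraticChar_dichotomy hm with h | h <;> simp [h, neg_eq_iff_eq_neg]

/-- The number of pairs with prescribed quadratic characters of `a - s ^ 2` and `a`. -/
theorem four_mul_card_pairs_quadraticChar (hK : ringChar K ≠ 2) {σ τ : ℤ} (hσ : σ = 1 ∨ σ = -1)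
    (hτ : τ = 1 ∨ τ = -1) :
    4 * (#{x : K × K | χ (x.1 - x.2 ^ 2) = σ ∧ χ x.1 = τ} : ℤ)
      = (Fintype.card K - 1) * (Fintype.card K - 1 - τ - χ (-1) * σ) := by
  have hm : (-1 : K) ≠ 0 := by simp
  have h0 : χ (-1) * σ = 1 ∨ χ (-1) * σ = -1 := by
    rcases quadraticChar_dichotomy hm with h | h <;> rcases hσ with rfl | rfl <;> simp [h]
  have h1 : (#{x : K × K | χ (x.1 - x.2 ^ 2) = σ ∧ χ x.1 = τ} : ℤ)
      = ∑ a : K with χ a = τ, (#{s : K | χ (s ^ 2 + -a) = χ (-1) * σ} : ℤ) := by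
    simp_rw [card_filter, ← quadraticChar_sub_sq_eq_iff]
    push_cast
    rw [Fintype.sum_prod_type, sum_filter]
    refine Finset.sum_congr rfl fun a _ => ?_
    split_ifs with h <;> simp only [h, and_true, and_false, if_false, sum_const_zero]
  have h2 : ∀ a ∈ ({a : K | χ a = τ} : Finset K),
      2 * (#{s : K | χ (s ^ 2 + -a) = χ (-1) * σ} : ℤ) = Fintype.card K - 1 - τ - χ (-1) * σ := by
    intro a ha
    simp only [mem_filter, mem_univ, true_and] at ha
    have ha0 : -a ≠ 0 := by
      rintro h
      rw [neg_eq_zero] at h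
      rw [h] at ha
      rcases hτ with rfl | rfl <;> simp at ha
    rw [two_mul_card_quadraticChar_sq_add hK ha0 h0, neg_neg, ha]
  have h3 : (4 : ℤ) * ∑ a : K with χ a = τ, (#{s : K | χ (s ^ 2 + -a) = χ (-1) * σ} : ℤ)
      = 2 * ∑ a : K with χ a = τ, 2 * (#{s : K | χ (s ^ 2 + -a) = χ (-1) * σ} : ℤ) := by
    rw [← mul_sum]; ring
  rw [h1, h3, Finset.sum_congr rfl h2, sum_const, nsmul_eq_mul, ← mul_assoc,
    two_mul_card_quadraticChar_eq hK hτ]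

/-- The first entry must vanish, leaving a condition on the character of -s². -/
theorem card_pairs_quadraticChar_zero_right {σ : ℤ} (hσ : σ = 1 ∨ σ = -1) :
    (#{x : K × K | χ (x.1 - x.2 ^ 2) = σ ∧ χ x.1 = 0} : ℤ)
      = if χ (-1) * σ = 1 then (Fintype.card K : ℤ) - 1 else 0 := by
  have hm : (-1 : K) ≠ 0 := by simp
  have h0 : χ (-1) * σ = 1 ∨ χ (-1) * σ = -1 := by
    rcases quadraticChar_dichotomy hm with h | h <;> rcases hσ with rfl | rfl <;> simp [h]
  rw [← card_quadraticChar_sq_eq _ h0]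
  norm_cast
  refine card_bij (fun x _ => x.2) ?_ ?_ ?_
  · rintro ⟨a, s⟩ h
    simp only [mem_filter, mem_univ, true_and, quadraticChar_sub_sq_eq_iff,
      quadraticChar_eq_zero_iff] at h ⊢
    obtain ⟨h, rfl⟩ := h
    simpa using h
  · rintro ⟨a, s⟩ h ⟨a', s'⟩ h' hs
    simp only [mem_filter, mem_univ, true_and, quadraticChar_eq_zero_iff] at h h' hs
    rw [h.2, h'.2, hs]
  · intro s hs
    refine ⟨(0, s), ?_, rfl⟩
    simp only [mem_filter, mem_univ, true_and, quadraticChar_sub_sq_eq_iff,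
      quadraticChar_eq_zero_iff] at hs ⊢
    simpa using hs

/-- The first entry is forced to be s². Thus τ = -1 never occurs here. -/
theorem card_pairs_quadraticChar_zero_left (τ : ℤ) :
    #{x : K × K | χ (x.1 - x.2 ^ 2) = 0 ∧ χ x.1 = τ} = #{s : K | χ (s ^ 2) = τ} := by
  refine card_bij (fun x _ => x.2) ?_ ?_ ?_
  · rintro ⟨a, s⟩ h
    simp only [mem_filter, mem_univ, true_and, quadraticChar_eq_zero_iff, sub_eq_zero] at h ⊢
    rw [← h.1, h.2]
  · rintro ⟨a, s⟩ h ⟨a', s'⟩ h' hs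
    simp only [mem_filter, mem_univ, true_and, quadraticChar_eq_zero_iff, sub_eq_zero] at h h' hs
    rw [h.1, h'.1, hs]
  · intro s hs
    refine ⟨(s ^ 2, s), ?_, rfl⟩
    simpa using hs

end QuadraticCharCounts

/-! ### The form Tr(x^(p+1)): nondegeneracy and value distribution. -/

section TraceNormForm

open Finset QuadraticMap

variable (p : ℕ) [Fact p.Prime] (F : Type*) [Field F] [Fintype F] [Algebra (ZMod p) F]

/-- The quadratic form `x ↦ Tr (x ^ (p + 1))` over the prime field. -/
noncomputable def traceNormForm : QuadraticForm (ZMod p) F :=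
  LinearMap.BilinMap.toQuadraticMap
    ((Algebra.traceForm (ZMod p) F).compl₂ (FiniteField.frobeniusAlgHom (ZMod p) F).toLinearMap)

variable {F}

omit [Fintype F] in
theorem traceNormForm_apply (x : F) :
    traceNormForm p F x = Algebra.trace (ZMod p) F (x ^ (p + 1)) := by
  simp [traceNormForm, ZMod.card, pow_succ']

theorem trace_pow_char (x : F) :
    Algebra.trace (ZMod p) F (x ^ p) = Algebra.trace (ZMod p) F x := by
  have h : Function.Bijective (FiniteField.frobeniusAlgHom (ZMod p) F) :=
    Finite.injective_iff_bijective.1 (FiniteField.frobeniusAlgHom (ZMod p) F).toRingHom.injective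
  have := Algebra.trace_eq_of_algEquiv (AlgEquiv.ofBijective _ h) x
  simpa [ZMod.card] using this

omit [Fintype F] in
theorem polar_traceNormForm (y v : F) :
    polar (traceNormForm p F) y v = Algebra.trace (ZMod p) F (y * v ^ p + v * y ^ p) := by
  rw [traceNormForm, LinearMap.BilinMap.polar_toQuadraticMap]
  simp [ZMod.card]

/-- Evaluating at a p-th power lets Frobenius invariance of the trace replace (wy)^p by wy, so the
polar functional appears as the functional of a code word. -/
theorem polar_traceNormForm_pow_char (y w : F) :
    polar (traceNormForm p F) y (w ^ p)
      = Algebra.trace (ZMod p) F ((w ^ (p ^ 2) + w) * y) := by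
  rw [polar_traceNormForm, map_add, ← mul_pow, trace_pow_char, ← map_add]
  congr 1
  ring

theorem exists_pow_char_eq (v : F) : ∃ w : F, w ^ p = v := by
  have h : Function.Bijective (FiniteField.frobeniusAlgHom (ZMod p) F) :=
    Finite.injective_iff_bijective.1 (FiniteField.frobeniusAlgHom (ZMod p) F).toRingHom.injective
  obtain ⟨w, hw⟩ := h.2 v
  exact ⟨w, by simpa [ZMod.card] using hw⟩

variable {p} {m : ℕ}

omit [Fintype F] in
theorem charP_of_algebra_zmod : CharP F p :=
  charP_of_injective_algebraMap (algebraMap (ZMod p) F).injective p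

omit [Fintype F] in
theorem two_ne_zero_of_algebra_zmod (hp : p ≠ 2) : (2 : F) ≠ 0 := by
  have : CharP F p := charP_of_algebra_zmod
  exact Ring.two_ne_zero (by rw [ringChar.eq F p]; exact hp)

/-- On such a w, the map x ↦ x^(p²) acts as -1. Its m-th iterate is the identity of F but sends w to
(-1)^m w = -w, so 2w = 0. -/
theorem eq_zero_of_pow_sq_char_add_self (hp : p ≠ 2) (hm : Odd m)
    (hF : Fintype.card F = p ^ (2 * m)) {w : F} (hw : w ^ (p ^ 2) + w = 0) : w = 0 := by
  have hodd : Odd (p ^ 2) := ((Fact.out : p.Prime).odd_of_ne_two hp).pow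
  have h1 : w ^ (p ^ 2) = -w := by linear_combination hw
  have h : ∀ k : ℕ, w ^ ((p ^ 2) ^ k) = (-1) ^ k * w := by
    intro k
    induction k with
    | zero => simp
    | succ k ih =>
      rw [pow_succ (p ^ 2) k, pow_mul, ih, mul_pow, h1, ← pow_mul, mul_comm k, pow_mul,
        hodd.neg_one_pow]
      ring
  have h2 := h m
  rw [← pow_mul, ← hF, FiniteField.pow_card, hm.neg_one_pow] at h2
  have h3 : 2 * w = 0 := by linear_combination h2
  simpa [two_ne_zero_of_algebra_zmod (p := p) (F := F) hp] using h3

theorem pow_sq_char_add_self_bijective (hp : p ≠ 2) (hm : Odd m)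
    (hF : Fintype.card F = p ^ (2 * m)) : Function.Bijective fun w : F => w ^ (p ^ 2) + w := by
  have : CharP F p := charP_of_algebra_zmod
  refine Finite.injective_iff_bijective.1 fun x y hxy => sub_eq_zero.1 ?_
  refine eq_zero_of_pow_sq_char_add_self hp hm hF ?_
  rw [sub_pow_char_pow]
  have hxy : x ^ p ^ 2 + x = y ^ p ^ 2 + y := hxy
  linear_combination hxy

theorem traceNormForm_nondegenerate (hp : p ≠ 2) (hm : Odd m)
    (hF : Fintype.card F = p ^ (2 * m)) (v : F)
    (hv : ∀ y, polar (traceNormForm p F) y v = 0) : v = 0 := by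
  obtain ⟨w, rfl⟩ := exists_pow_char_eq p v
  have h : w ^ (p ^ 2) + w = 0 := by
    refine (traceForm_nondegenerate (ZMod p) F).1 _ fun y => ?_
    rw [Algebra.traceForm_apply, ← polar_traceNormForm_pow_char]
    exact hv y
  rw [eq_zero_of_pow_sq_char_add_self hp hm hF h, zero_pow (Fact.out : p.Prime).ne_zero]

omit [Fact p.Prime] [Field F] [Algebra (ZMod p) F] in
theorem sq_char_sub_one_dvd (hF : Fintype.card F = p ^ (2 * m)) :
    (p + 1) * (p - 1) ∣ Fintype.card F - 1 := by
  rw [hF, pow_mul, ← Nat.sq_sub_sq, one_pow]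
  simpa using Nat.sub_dvd_pow_sub_pow (p ^ 2) 1 m

/-- Write c = g^k for a generator g of the unit group. As c^(p-1) = 1, the order of g divides
k(p-1); since (p+1)(p-1) divides that order, p+1 divides k. -/
theorem exists_pow_char_add_one_eq (hF : Fintype.card F = p ^ (2 * m)) {c : ZMod p} (hc : c ≠ 0) :
    ∃ l : F, l ^ (p + 1) = algebraMap (ZMod p) F c := by
  classical
  have hp1 : 0 < p - 1 := Nat.sub_pos_of_lt (Fact.out : p.Prime).one_lt
  obtain ⟨g, hg⟩ := IsCyclic.exists_generator (α := Fˣ)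
  have ho : orderOf g = Fintype.card F - 1 := by
    rw [orderOf_eq_card_of_forall_mem_zpowers hg, Nat.card_eq_fintype_card, Fintype.card_units]
  have hc' : algebraMap (ZMod p) F c ≠ 0 := by simpa using hc
  obtain ⟨k, hk⟩ := (mem_powers_iff_mem_zpowers.2 (hg (Units.mk0 _ hc')))
  have hk' : g ^ k = Units.mk0 _ hc' := hk
  have h1 : g ^ (k * (p - 1)) = 1 := by
    rw [pow_mul, hk']
    ext
    rw [Units.val_pow_eq_pow_val, Units.val_mk0, ← map_pow, ZMod.pow_card_sub_one_eq_one hc]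
    simp
  have h2 : (p + 1) * (p - 1) ∣ k * (p - 1) :=
    (sq_char_sub_one_dvd hF).trans (ho ▸ orderOf_dvd_of_pow_eq_one h1)
  obtain ⟨j, rfl⟩ := Nat.dvd_of_mul_dvd_mul_right hp1 h2
  refine ⟨(g ^ j : Fˣ), ?_⟩
  have := congrArg Units.val hk'
  rw [Units.val_mk0, mul_comm, pow_mul, Units.val_pow_eq_pow_val] at this
  exact this

omit [Fact p.Prime] [Algebra (ZMod p) F] in
-- F contains a primitive (p+1)-th root of unity, so each fibre of x ↦ x^(p+1) over a nonzero
-- element has 0 or p+1 points. This congruence later fixes the sign of the excess.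
theorem char_add_one_dvd_card_pow_mem (hF : Fintype.card F = p ^ (2 * m)) (P : F → Prop)
    [DecidableEq F] [DecidablePred P] : p + 1 ∣ #{x : F | x ≠ 0 ∧ P (x ^ (p + 1))} := by
  classical
  obtain ⟨g, hg⟩ := IsCyclic.exists_generator (α := Fˣ)
  have ho : orderOf g = Fintype.card F - 1 := by
    rw [orderOf_eq_card_of_forall_mem_zpowers hg, Nat.card_eq_fintype_card, Fintype.card_units]
  obtain ⟨d, hd⟩ := (Dvd.intro _ rfl).trans (sq_char_sub_one_dvd hF)
  have hprim : IsPrimitiveRoot ((g : F) ^ d) (p + 1) := by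
    refine IsPrimitiveRoot.pow (n := Fintype.card F - 1) ?_ ?_ (by rw [hd, mul_comm])
    · have := Fintype.one_lt_card (α := F); omega
    · rw [IsPrimitiveRoot.coe_units_iff, ← ho]; exact IsPrimitiveRoot.orderOf g
  rw [card_eq_sum_card_fiberwise (f := fun x => x ^ (p + 1)) (t := univ)
    (fun _ _ => mem_coe.2 (mem_univ _))]
  refine dvd_sum fun y _ => ?_
  by_cases hy : y ≠ 0 ∧ P y
  · have : ({x ∈ ({x : F | x ≠ 0 ∧ P (x ^ (p + 1))} : Finset F) | x ^ (p + 1) = y} : Finset F)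
        = (Polynomial.nthRoots (p + 1) y).toFinset := by
      ext x
      simp only [mem_filter, mem_univ, true_and, Multiset.mem_toFinset,
        Polynomial.mem_nthRoots (Nat.succ_pos p)]
      constructor
      · exact fun h => h.2
      · rintro rfl
        exact ⟨⟨fun h => hy.1 (by rw [h, zero_pow (Nat.succ_ne_zero p)]), hy.2⟩, rfl⟩
    rw [this, Multiset.toFinset_card_of_nodup (hprim.nthRoots_nodup hy.1), hprim.card_nthRoots]
    split_ifs <;> simp
  · rw [filter_eq_empty_iff.2]
    · simp
    · intro x hx hxy
      simp only [mem_filter, mem_univ, true_and] at hx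
      exact hy ⟨hxy ▸ pow_ne_zero _ hx.1, hxy ▸ hx.2⟩

/-- The value distribution of `x ↦ Tr (x ^ (p + 1))`. -/
theorem card_traceNormForm_eq (hp : p ≠ 2) (hm : Odd m) (hF : Fintype.card F = p ^ (2 * m)) :
    ∃ N : ℤ, ∀ c, (#{x : F | traceNormForm p F x = c} : ℤ) = N + if c = 0 then -(p : ℤ) ^ m else 0 := by
  classical
  set Q := traceNormForm p F with hQ
  set N : ℤ := (#{x : F | Q x = 1} : ℤ) with hN
  set S : ℤ := #{x : F | Q x = 0} - N with hS
  have hlev : ∀ c, (#{x : F | Q x = c} : ℤ) = N + if c = 0 then S else 0 := by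
    intro c
    split_ifs with hc
    · rw [hc, hS]; ring
    rw [add_zero, hN]
    -- Multiplication by l scales Q by c, so it carries the level set of 1 onto that of c.
    obtain ⟨l, hl⟩ := exists_pow_char_add_one_eq (F := F) hF hc
    have hl0 : l ≠ 0 := by
      rintro rfl
      rw [zero_pow (Nat.succ_ne_zero p)] at hl
      exact hc (by simpa using hl.symm)
    have hmul : ∀ x, Q (l * x) = c * Q x := by
      intro x
      rw [hQ, traceNormForm_apply, traceNormForm_apply, mul_pow, hl, ← Algebra.smul_def, map_smul,
        smul_eq_mul]
    norm_cast
    symm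
    refine card_bij (fun x _ => l * x) ?_ ?_ ?_
    · intro x hx
      simp only [mem_filter, mem_univ, true_and] at hx ⊢
      rw [hmul, hx, mul_one]
    · intro x _ y _ h
      exact mul_left_cancel₀ hl0 h
    · intro x hx
      simp only [mem_filter, mem_univ, true_and] at hx
      refine ⟨x / l, ?_, mul_div_cancel₀ _ hl0⟩
      have := hmul (x / l)
      rw [mul_div_cancel₀ _ hl0, hx] at this
      simp only [mem_filter, mem_univ, true_and]
      exact mul_left_cancel₀ hc (by rw [← this, mul_one])
  have hsq := sq_excess_eq_card Q (traceNormForm_nondegenerate hp hm hF) hlev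
  have hdN : ((p : ℤ) + 1) ∣ N := by
    have h := char_add_one_dvd_card_pow_mem (F := F) hF
      (fun y => Algebra.trace (ZMod p) F y = 1)
    have e : ({x : F | x ≠ 0 ∧ Algebra.trace (ZMod p) F (x ^ (p + 1)) = 1} : Finset F)
        = ({x : F | Q x = 1} : Finset F) := by
      ext x
      simp only [mem_filter, mem_univ, true_and, hQ, traceNormForm_apply]
      refine ⟨fun h => h.2, fun h => ⟨?_, h⟩⟩
      rintro rfl
      simp at h
    rw [e] at h
    rw [hN]; exact_mod_cast h
  have hdZ : ((p : ℤ) + 1) ∣ #{x : F | Q x = 0} - 1 := by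
    have h := char_add_one_dvd_card_pow_mem (F := F) hF
      (fun y => Algebra.trace (ZMod p) F y = 0)
    have e : ({x : F | x ≠ 0 ∧ Algebra.trace (ZMod p) F (x ^ (p + 1)) = 0} : Finset F)
        = ({x : F | Q x = 0} : Finset F).erase 0 := by
      ext x
      simp [hQ, traceNormForm_apply]
    have h0 : (0 : F) ∈ ({x : F | Q x = 0} : Finset F) := by simp
    rw [e] at h
    have h1 := card_erase_add_one h0
    rw [← h1]
    push_cast
    rw [add_sub_cancel_right]
    exact_mod_cast h
  have hdS : ((p : ℤ) + 1) ∣ S - 1 := by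
    have := dvd_sub hdZ hdN
    rwa [show (#{x : F | Q x = 0} : ℤ) - 1 - N = S - 1 by rw [hS]; ring] at this
  have hS2 : S = (p : ℤ) ^ m ∨ S = -(p : ℤ) ^ m := by
    refine sq_eq_sq_iff_eq_or_eq_neg.1 ?_
    rw [hsq, hF]; push_cast; rw [← pow_mul, mul_comm]
  -- For odd m, p+1 divides p^m + 1. Together with S ≡ 1 mod p+1, the value S = p^m would make p+1
  -- divide 2.
  have hne : S ≠ (p : ℤ) ^ m := by
    intro h
    have h1 : ((p : ℤ) + 1) ∣ (p : ℤ) ^ m + 1 := by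
      simpa using hm.add_dvd_pow_add_pow (p : ℤ) 1
    have h2 := dvd_sub h1 hdS
    rw [h, show (p : ℤ) ^ m + 1 - ((p : ℤ) ^ m - 1) = 2 by ring] at h2
    have h3 := Int.le_of_dvd (by norm_num) h2
    have := (Fact.out : p.Prime).two_le
    omega
  refine ⟨N, fun c => ?_⟩
  rw [hlev c, hS2.resolve_left hne]

end TraceNormForm

/-! ### Weight tables from a classification of code words. -/

section WeightTables

open Finset

theorem List.sum_map_filter_eq {α : Type*} (T : List α) (P : α → Prop) [DecidablePred P]
    (f : α → ℚ) : ((T.filter (fun r => P r)).map f).sum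
      = (T.map fun r => if P r then f r else 0).sum := by
  induction T with
  | nil => simp
  | cons a T ih =>
    by_cases h : P a <;> simp [h, ih]

/-- A weight table can be read off from a classification of an injective parametrization of
the code words. -/
theorem hasWeightTable_ofFn {p : ℕ} [Fact p.Prime] {ι X : Type*} [Fintype ι] [Fintype X] {n : ℕ}
    (C : Submodule (ZMod p) (ι → ZMod p)) (φ : X → ι → ZMod p) (hφ : Function.Injective φ)
    (hC : ∀ c, c ∈ C ↔ ∃ x, φ x = c) (row : Fin n → ℚ × ℚ) (cls : X → Fin n)
    (hw : ∀ x, (hammingNorm (φ x) : ℚ) = (row (cls x)).1)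
    (hm : ∀ j, (#{x : X | cls x = j} : ℚ) = (row j).2) : HasWeightTable C (List.ofFn row) := by
  classical
  intro w
  have h1 : weightCount C w = #{x : X | hammingNorm (φ x) = w} := by
    rw [weightCount, ← Set.ncard_coe_finset, ← Set.ncard_image_of_injective _ hφ]
    congr 1
    ext c
    simp only [Set.mem_ofPred_eq, hC, coe_filter, mem_univ, true_and, Set.mem_image]
    constructor
    · rintro ⟨⟨x, rfl⟩, h⟩; exact ⟨x, h, rfl⟩
    · rintro ⟨x, h, rfl⟩; exact ⟨⟨x, rfl⟩, h⟩
  -- Splitting by class, each row of weight w contributes its whole class and every other row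
  -- nothing; rows with coinciding weights thus add up without special treatment.
  rw [h1, List.sum_map_filter_eq _ (fun r : ℚ × ℚ => r.1 = (w : ℚ)), List.map_ofFn, List.sum_ofFn,
    card_eq_sum_card_fiberwise (f := cls) (t := univ) (fun _ _ => mem_coe.2 (mem_univ _))]
  push_cast
  refine Finset.sum_congr rfl fun j _ => ?_
  simp only [Function.comp]
  split_ifs with h
  · rw [← hm j]
    congr 2
    ext x
    simp only [mem_filter, mem_univ, true_and, and_iff_right_iff_imp]
    rintro rfl
    rw [← hw x] at h
    exact_mod_cast h
  · rw [filter_eq_empty_iff.2]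
    · simp
    · intro x hx hj
      simp only [mem_filter, mem_univ, true_and] at hx
      apply h
      rw [← hj, ← hw x, hx]

/-- The number of nonzero weights is at most the number of further rows of the table. -/
theorem HasWeightTable.card_weights_le {p : ℕ} {ι : Type*} [Fintype ι]
    {C : Submodule (ZMod p) (ι → ZMod p)} {r : ℚ × ℚ} {T : List (ℚ × ℚ)} (hr : r.1 = 0)
    (h : HasWeightTable C (r :: T)) (n : ℕ) :
    #{w ∈ Finset.Icc 1 n | weightCount C w ≠ 0} ≤ T.length := by
  calc #{w ∈ Finset.Icc 1 n | weightCount C w ≠ 0}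
      ≤ #((T.map Prod.fst).toFinset) := by
        refine card_le_card_of_injOn (fun w : ℕ => (w : ℚ)) ?_ (fun a _ b _ h => by simpa using h)
        intro w hw
        simp only [coe_filter, mem_Icc, Set.mem_ofPred_eq] at hw
        have h1 := h w
        have h2 : ((weightCount C w : ℕ) : ℚ) ≠ 0 := by exact_mod_cast hw.2
        by_contra hcon
        apply h2
        rw [h1, List.filter_eq_nil_iff.2]
        · simp
        · intro s hs hsw
          simp only [decide_eq_true_eq] at hsw
          rcases List.mem_cons.1 hs with rfl | hs
          · rw [hr] at hsw
            have : w = 0 := by exact_mod_cast hsw.symm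
            omega
          · apply hcon
            simp only [List.coe_toFinset, Set.mem_ofPred_eq, List.mem_map]
            exact ⟨s, hs, hsw⟩
    _ ≤ (T.map Prod.fst).length := List.toFinset_card_le _
    _ = T.length := List.length_map _

end WeightTables

/-! ### Joint distributions, length of the code, and zero coordinates. -/

section TraceCodeWeights

open Finset QuadraticMap

variable {p : ℕ} [Fact p.Prime] {F : Type*} [Field F] [Fintype F] [Algebra (ZMod p) F] {m : ℕ}

local notation "χ" => quadraticChar (ZMod p)
local notation "Q" => traceNormForm p F
local notation "Tr" => Algebra.trace (ZMod p) F

theorem mem_cyclotomicClassTwo_iff (c : ZMod p) (i : Fin 2) :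
    c ∈ cyclotomicClassTwo p i ↔ χ c = (-1) ^ (i : ℕ) := by
  rw [cyclotomicClassTwo, Set.mem_ofPred_eq]
  by_cases hc : c = 0
  · simp only [hc, ne_eq, not_true, false_and, MulChar.map_zero, false_iff]
    exact fun h => pow_ne_zero (i : ℕ) (by norm_num : (-1 : ℤ) ≠ 0) h.symm
  · fin_cases i
    · simp [hc, ← quadraticChar_one_iff_isSquare hc]
    · have := quadraticChar_neg_one_iff_not_isSquare (a := c)
      change c ≠ 0 ∧ (IsSquare c ↔ (1 : Fin 2) = 0) ↔ χ c = (-1) ^ 1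
      rw [pow_one, this]
      simp [hc]

theorem finrank_of_card (hF : Fintype.card F = p ^ (2 * m)) :
    Module.finrank (ZMod p) F = 2 * m := by
  have := Module.card_eq_pow_finrank (K := ZMod p) (V := F)
  rw [hF, ZMod.card] at this
  exact (Nat.pow_right_injective (Fact.out : p.Prime).two_le this).symm

theorem two_ne_zero_zmod (hp : p ≠ 2) : (2 : ZMod p) ≠ 0 :=
  Ring.two_ne_zero (by rwa [ZMod.ringChar_zmod_n])

theorem four_ne_zero_zmod (hp : p ≠ 2) : (4 : ZMod p) ≠ 0 := by
  have : (4 : ZMod p) = 2 * 2 := by norm_num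
  rw [this]; exact mul_ne_zero (two_ne_zero_zmod hp) (two_ne_zero_zmod hp)

theorem traceNormForm_half (hp : p ≠ 2) (hF : Fintype.card F = p ^ (2 * m)) :
    Q (algebraMap (ZMod p) F 2⁻¹) = ((2 * m : ℕ) : ZMod p) / 4 := by
  have h2 := two_ne_zero_zmod hp
  have h4 := four_ne_zero_zmod hp
  rw [traceNormForm_apply, ← map_pow, Algebra.trace_algebraMap, finrank_of_card hF, pow_succ,
    ZMod.pow_card, nsmul_eq_mul, div_eq_mul_inv]
  congr 1
  field_simp
  norm_num

theorem trace_half (hF : Fintype.card F = p ^ (2 * m)) :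
    Tr (algebraMap (ZMod p) F 2⁻¹) = ((2 * m : ℕ) : ZMod p) / 2 := by
  rw [Algebra.trace_algebraMap, finrank_of_card hF, nsmul_eq_mul, div_eq_mul_inv]

/-- Frobenius fixes 1/2, so each of the two polar terms contributes half the trace. This is what
makes translation by 1/2 cancel the linear term, and what makes (Q, Tr) a case of the joint
distribution. -/
theorem polar_half (hp : p ≠ 2) (y : F) : polar Q y (algebraMap (ZMod p) F 2⁻¹) = Tr y := by
  have h2 := two_ne_zero_zmod hp
  rw [polar_traceNormForm, ← map_pow, ZMod.pow_card, mul_comm y, ← Algebra.smul_def,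
    ← Algebra.smul_def, map_add, map_smul, map_smul, trace_pow_char, ← add_smul, smul_eq_mul]
  have : (2⁻¹ + 2⁻¹ : ZMod p) = 1 := by field_simp; norm_num
  rw [this, one_mul]

/-- Translation by `1 / 2` turns the defining polynomial into a quadratic form. -/
theorem trace_add_half (hp : p ≠ 2) (hF : Fintype.card F = p ^ (2 * m)) (y : F) :
    Tr ((y + algebraMap (ZMod p) F 2⁻¹) ^ (p + 1) - (y + algebraMap (ZMod p) F 2⁻¹))
      = Q y - ((2 * m : ℕ) : ZMod p) / 4 := by
  have h2 := two_ne_zero_zmod hp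
  have h4 := four_ne_zero_zmod hp
  rw [map_sub, ← traceNormForm_apply, map_add_polar, polar_half hp, traceNormForm_half hp hF,
    map_add, trace_half hF]
  have : ((2 * m : ℕ) : ZMod p) / 2 = 2 * (((2 * m : ℕ) : ZMod p) / 4) := by
    field_simp; ring
  rw [this]; ring

theorem card_traceNormForm_polar (hp : p ≠ 2) (hm : Odd m) (hF : Fintype.card F = p ^ (2 * m))
    {v : F} (hv : v ≠ 0) (c t : ZMod p) :
    (#{y : F | Q y = c ∧ polar Q y v = t} : ℤ) = (p : ℤ) ^ (2 * m - 2)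
      - (p : ℤ) ^ (m - 1) * (#{g : ZMod p | Q v * g ^ 2 + t * g + c = 0} - 1) := by
  obtain ⟨N, hN⟩ := card_traceNormForm_eq (F := F) hp hm hF
  have hm0 := hm.pos
  have hp0 : (p : ℤ) ≠ 0 := by exact_mod_cast (Fact.out : p.Prime).ne_zero
  have e1 : (p : ℤ) ^ (2 * m) = p * p ^ (2 * m - 1) := by rw [← pow_succ']; congr 1; omega
  have e2 : (p : ℤ) ^ (2 * m - 1) = p * p ^ (2 * m - 2) := by rw [← pow_succ']; congr 1; omega
  have e3 : (p : ℤ) ^ m = p * p ^ (m - 1) := by rw [← pow_succ']; congr 1; omega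
  have := card_mul_card_eq_and_polar_eq Q (traceNormForm_nondegenerate hp hm hF) hN
    (h := (p : ℤ) ^ (2 * m - 1)) (by rw [hF, ZMod.card]; push_cast; exact e1) hv c t
  rw [ZMod.card, e2, e3] at this
  refine mul_left_cancel₀ hp0 ?_
  rw [this]; ring

theorem ringChar_zmod_ne_two (hp : p ≠ 2) : ringChar (ZMod p) ≠ 2 := by
  rwa [ZMod.ringChar_zmod_n]

/-- The joint distribution of `Tr (x ^ (p + 1))` and `Tr x`. -/
theorem card_traceNormForm_trace (hp : p ≠ 2) (hm : Odd m) (hF : Fintype.card F = p ^ (2 * m))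
    (hE : ((2 * m : ℕ) : ZMod p) ≠ 0) (A s : ZMod p) :
    (#{y : F | Q y = A ∧ Tr y = s} : ℤ) = (p : ℤ) ^ (2 * m - 2)
      - (p : ℤ) ^ (m - 1) * (χ (-1) * χ (((2 * m : ℕ) : ZMod p) * A - s ^ 2)) := by
  have h2 := two_ne_zero_zmod hp
  have h4 := four_ne_zero_zmod hp
  have hv : algebraMap (ZMod p) F 2⁻¹ ≠ 0 := by simpa using h2
  have h := card_traceNormForm_polar hp hm hF hv A s
  simp only [polar_half hp] at h
  rw [h, traceNormForm_half hp hF,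
    card_filter_quadratic_eq_zero (ringChar_zmod_ne_two hp) (div_ne_zero hE h4), ← map_mul]
  congr 2
  rw [add_sub_cancel_right]
  congr 1
  field_simp
  ring

/-- The number of elements with prescribed quadratic characters. -/
theorem card_quadraticChar_traceNormForm (hp : p ≠ 2) (hm : Odd m)
    (hF : Fintype.card F = p ^ (2 * m)) (hE : ((2 * m : ℕ) : ZMod p) ≠ 0) (σ τ : ℤ) :
    (#{y : F | χ (((2 * m : ℕ) : ZMod p) * Q y - (Tr y) ^ 2) = σ
        ∧ χ (((2 * m : ℕ) : ZMod p) * Q y) = τ} : ℤ)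
      = #{x : ZMod p × ZMod p | χ (x.1 - x.2 ^ 2) = σ ∧ χ x.1 = τ}
        * ((p : ℤ) ^ (2 * m - 2) - (p : ℤ) ^ (m - 1) * (χ (-1) * σ)) := by
  set E : ZMod p := ((2 * m : ℕ) : ZMod p)
  -- The size of the fibre over (a, s) depends only on the character of a - s², which is σ on the
  -- whole index set.
  rw [card_eq_sum_card_fiberwise (f := fun y => (E * Q y, Tr y))
    (t := {x : ZMod p × ZMod p | χ (x.1 - x.2 ^ 2) = σ ∧ χ x.1 = τ})
    (fun y hy => by simpa using hy)]
  push_cast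
  rw [← nsmul_eq_mul, ← sum_const]
  refine Finset.sum_congr rfl ?_
  rintro ⟨a, s⟩ h
  simp only [mem_filter, mem_univ, true_and] at h
  have h1 := card_traceNormForm_trace hp hm hF hE (a / E) s
  rw [mul_div_cancel₀ _ hE, h.1] at h1
  rw [← h1]
  congr 2
  ext y
  simp only [mem_filter, mem_univ, true_and, Prod.mk.injEq]
  constructor
  · rintro ⟨-, rfl, rfl⟩
    exact ⟨(mul_div_cancel_left₀ _ hE).symm, rfl⟩
  · rintro ⟨h2, rfl⟩
    have h3 : E * Q y = a := by rw [h2, mul_div_cancel₀ _ hE]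
    exact ⟨⟨by rw [h3]; exact h.1, by rw [h3]; exact h.2⟩, h3, rfl⟩

theorem card_filter_add_half (P : F → Prop) [DecidablePred P] :
    #{x : F | P x} = #{y : F | P (y + algebraMap (ZMod p) F 2⁻¹)} := by
  symm
  refine card_bij (fun y _ => y + algebraMap (ZMod p) F 2⁻¹) ?_ ?_ ?_
  · intro y hy; simpa using hy
  · intro x _ y _ h; simpa using h
  · intro x hx
    exact ⟨x - algebraMap (ZMod p) F 2⁻¹, by simpa using hx, by simp⟩

variable {i : Fin 2}

/-- The hypothesis on i puts e in the i-th class, so i can be eliminated in favour of the character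
of e. -/
theorem mem_definingSet_iff (hi : legendreSym p ((2 * m : ℕ) : ℤ) = (-1) ^ (i : ℕ)) (x : F) :
    x ∈ definingSet p F i ↔ χ (Tr (x ^ (p + 1) - x)) = χ ((2 * m : ℕ) : ZMod p) := by
  simp only [definingSet, mem_filter, mem_univ, true_and, mem_cyclotomicClassTwo_iff, ← hi,
    legendreSym, Int.cast_natCast]

theorem quadraticChar_neg_div_four (hp : p ≠ 2) (E : ZMod p) : χ (-(E / 4)) = χ (-1) * χ E := by
  have h4 := four_ne_zero_zmod hp
  have h : -E = -(E / 4) * 4 := by field_simp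
  have h' := congrArg χ h
  rw [map_mul, quadraticChar_four (ringChar_zmod_ne_two hp), mul_one] at h'
  rw [← h', ← map_mul, neg_one_mul]

theorem two_mul_card_filter_quadraticChar_eq (hp : p ≠ 2) {E : ZMod p} (hE : E ≠ 0) :
    2 * (#{c : ZMod p | χ c = χ E} : ℤ) = p - 1 := by
  have := two_mul_card_quadraticChar_eq (ringChar_zmod_ne_two hp) (quadraticChar_dichotomy hE)
  rwa [ZMod.card] at this

/-- After translation the level sets of Q are summed over a shifted cyclotomic class. The
exceptional level Q = 0 corresponds to c = -E/4, which has the character of E exactly when -1 is a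
square. -/
theorem two_mul_card_definingSet (hp : p ≠ 2) (hm : Odd m) (hF : Fintype.card F = p ^ (2 * m))
    (hE : ((2 * m : ℕ) : ZMod p) ≠ 0)
    (hi : legendreSym p ((2 * m : ℕ) : ℤ) = (-1) ^ (i : ℕ)) :
    2 * (#(definingSet p F i) : ℤ)
      = (p - 1) * (p * (p : ℤ) ^ (2 * m - 2) + (p : ℤ) ^ (m - 1))
        - (if χ (-1) = 1 then 2 * (p * (p : ℤ) ^ (m - 1)) else 0) := by
  set E : ZMod p := ((2 * m : ℕ) : ZMod p)
  obtain ⟨N, hN⟩ := card_traceNormForm_eq (F := F) hp hm hF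
  have hm0 := hm.pos
  have hp0 : (p : ℤ) ≠ 0 := by exact_mod_cast (Fact.out : p.Prime).ne_zero
  have e1 : (p : ℤ) ^ (2 * m) = p * (p * p ^ (2 * m - 2)) := by
    rw [← pow_succ', ← pow_succ']; congr 1; omega
  have e3 : (p : ℤ) ^ m = p * p ^ (m - 1) := by rw [← pow_succ']; congr 1; omega
  have hNval : N = p * (p : ℤ) ^ (2 * m - 2) + (p : ℤ) ^ (m - 1) := by
    have := card_eq_of_card_level Q hN
    rw [hF, ZMod.card] at this
    push_cast at this
    rw [e1, e3] at this
    refine mul_left_cancel₀ hp0 ?_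
    linear_combination -this
  have h1 : #(definingSet p F i) = #{y : F | χ (Q y - E / 4) = χ E} := by
    have : definingSet p F i = ({x : F | χ (Tr (x ^ (p + 1) - x)) = χ E} : Finset F) := by
      ext x; simp only [mem_definingSet_iff hi, mem_filter, mem_univ, true_and, E]
    rw [this, card_filter_add_half (p := p)]
    simp only [trace_add_half hp hF, E]
  have h2 : (#(definingSet p F i) : ℤ)
      = ∑ c : ZMod p with χ c = χ E, (N + if c + E / 4 = 0 then -(p : ℤ) ^ m else 0) := by
    rw [h1, card_eq_sum_card_fiberwise (f := fun y => Q y - E / 4)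
      (t := {c : ZMod p | χ c = χ E}) (fun y hy => by simpa using hy)]
    push_cast
    refine Finset.sum_congr rfl fun c hc => ?_
    simp only [mem_filter, mem_univ, true_and] at hc
    rw [← hN]
    congr 2
    ext y
    simp only [mem_filter, mem_univ, true_and, sub_eq_iff_eq_add]
    refine ⟨fun h => h.2, fun h => ⟨?_, h⟩⟩
    rw [h, add_sub_cancel_right, hc]
  have h3 : ∑ c : ZMod p with χ c = χ E, (if c + E / 4 = 0 then -(p : ℤ) ^ m else 0)
      = if χ (-1) = 1 then -(p : ℤ) ^ m else 0 := by
    simp_rw [add_eq_zero_iff_eq_neg]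
    rw [sum_ite_eq']
    simp only [mem_filter, mem_univ, true_and, quadraticChar_neg_div_four hp]
    have hm : (-1 : ZMod p) ≠ 0 := by simp
    rcases quadraticChar_dichotomy hm with h | h <;> rcases quadraticChar_dichotomy hE with h' | h'
      <;> simp [h, h']
  rw [h2, sum_add_distrib, h3, sum_const, nsmul_eq_mul, mul_add, ← mul_assoc,
    two_mul_card_filter_quadraticChar_eq hp hE, hNval, e3]
  split_ifs <;> ring

/-- The number of zero coordinates of a code word. -/
theorem two_mul_card_zero_coordinates (hp : p ≠ 2) (hm : Odd m)
    (hF : Fintype.card F = p ^ (2 * m)) (hE : ((2 * m : ℕ) : ZMod p) ≠ 0)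
    (hi : legendreSym p ((2 * m : ℕ) : ℤ) = (-1) ^ (i : ℕ)) {w : F} (hw : w ≠ 0) :
    2 * (#{x ∈ definingSet p F i | Tr ((w ^ (p ^ 2) + w) * x) = 0} : ℤ)
      = (p - 1) * ((p : ℤ) ^ (2 * m - 2) + (p : ℤ) ^ (m - 1))
        - 2 * (p : ℤ) ^ (m - 1) * #{g : ZMod p |
          χ (-(Q w * g ^ 2 - Tr w * g + ((2 * m : ℕ) : ZMod p) / 4)) = χ ((2 * m : ℕ) : ZMod p)} := by
  set E : ZMod p := ((2 * m : ℕ) : ZMod p) with hEdef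
  have hQw : Q (w ^ p) = Q w := by
    rw [traceNormForm_apply, traceNormForm_apply, ← pow_mul, mul_comm, pow_mul, trace_pow_char]
  have hv : w ^ p ≠ 0 := pow_ne_zero _ hw
  -- Translation by 1/2 adds B(1/2, w^p) = Tr(w^p) = Tr(w) to the linear condition.
  have h1 : #{x ∈ definingSet p F i | Tr ((w ^ (p ^ 2) + w) * x) = 0}
      = #{y : F | χ (Q y - E / 4) = χ E ∧ polar Q y (w ^ p) = -Tr w} := by
    have : ({x ∈ definingSet p F i | Tr ((w ^ (p ^ 2) + w) * x) = 0} : Finset F)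
        = ({x : F | χ (Tr (x ^ (p + 1) - x)) = χ E ∧ polar Q x (w ^ p) = 0} : Finset F) := by
      ext x
      simp only [mem_definingSet_iff hi, mem_filter, mem_univ, true_and, E,
        polar_traceNormForm_pow_char]
    rw [this, card_filter_add_half (p := p)]
    simp only [trace_add_half hp hF, polar_add_left, E]
    simp only [polar_comm Q (algebraMap (ZMod p) F 2⁻¹), polar_half hp, trace_pow_char,
      add_eq_zero_iff_eq_neg]
  have h2 : (#{x ∈ definingSet p F i | Tr ((w ^ (p ^ 2) + w) * x) = 0} : ℤ)
      = ∑ c : ZMod p with χ c = χ E, ((p : ℤ) ^ (2 * m - 2) - (p : ℤ) ^ (m - 1) *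
          (#{g : ZMod p | Q w * g ^ 2 + -Tr w * g + (c + E / 4) = 0} - 1)) := by
    rw [h1, card_eq_sum_card_fiberwise (f := fun y => Q y - E / 4)
      (t := {c : ZMod p | χ c = χ E}) (fun y hy => by
        simp only [coe_filter, mem_univ, true_and, Set.mem_ofPred_eq] at hy ⊢; exact hy.1)]
    push_cast
    refine Finset.sum_congr rfl fun c hc => ?_
    simp only [mem_filter, mem_univ, true_and] at hc
    rw [← hQw, ← card_traceNormForm_polar hp hm hF hv]
    congr 2
    ext y
    simp only [mem_filter, mem_univ, true_and, sub_eq_iff_eq_add]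
    refine ⟨fun h => ⟨h.2, h.1.2⟩, fun h => ⟨⟨?_, h.2⟩, h.1⟩⟩
    rw [h.1, add_sub_cancel_right, hc]
  -- Each g is a root for exactly one c, so the root counts over the class add up to a single count
  -- of g.
  have h3 : (#{g : ZMod p | χ (-(Q w * g ^ 2 - Tr w * g + E / 4)) = χ E} : ℤ)
      = ∑ c : ZMod p with χ c = χ E,
          (#{g : ZMod p | Q w * g ^ 2 + -Tr w * g + (c + E / 4) = 0} : ℤ) := by
    rw [card_eq_sum_card_fiberwise (f := fun g => -(Q w * g ^ 2 - Tr w * g + E / 4))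
      (t := {c : ZMod p | χ c = χ E}) (fun y hy => by simpa using hy)]
    push_cast
    refine Finset.sum_congr rfl fun c hc => ?_
    simp only [mem_filter, mem_univ, true_and] at hc
    congr 2
    ext g
    simp only [mem_filter, mem_univ, true_and]
    constructor
    · rintro ⟨-, h⟩; linear_combination -h
    · intro h
      have : -(Q w * g ^ 2 - Tr w * g + E / 4) = c := by linear_combination -h
      exact ⟨by rw [this, hc], this⟩
  have h4 := two_mul_card_filter_quadraticChar_eq hp hE
  rw [h2, h3, sum_sub_distrib, ← mul_sum, sum_sub_distrib, sum_const, sum_const, nsmul_eq_mul,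
    nsmul_eq_mul]
  linear_combination ((p : ℤ) ^ (2 * m - 2) + (p : ℤ) ^ (m - 1)) * h4

end TraceCodeWeights

/-! ### Weights as functions of the two characters. -/

section WeightDistribution

open Finset QuadraticMap

variable {p : ℕ} [Fact p.Prime] {F : Type*} [Field F] [Fintype F] [Algebra (ZMod p) F] {m : ℕ}
  {i : Fin 2}

local notation "χ" => quadraticChar (ZMod p)
local notation "Q" => traceNormForm p F
local notation "Tr" => Algebra.trace (ZMod p) F

/-- The encoding map of a trace code. -/
noncomputable def traceEncoding (D : Finset F) : F →ₗ[ZMod p] (D → ZMod p) :=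
  LinearMap.pi fun d => (Algebra.traceForm (ZMod p) F).flip d

omit [Fintype F] in
theorem traceEncoding_apply (D : Finset F) (a : F) (d : D) :
    traceEncoding (p := p) D a d = Tr (a * d) := by
  simp [traceEncoding]

omit [Fintype F] in
theorem range_traceEncoding (D : Finset F) :
    LinearMap.range (traceEncoding (p := p) D) = traceCode p D := by
  ext c
  constructor
  · rintro ⟨a, rfl⟩; exact ⟨a, funext fun d => traceEncoding_apply D a d⟩
  · rintro ⟨a, rfl⟩; exact ⟨a, funext fun d => traceEncoding_apply D a d⟩

omit [Fintype F] in
theorem hammingNorm_traceEncoding (D : Finset F) (a : F) :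
    (hammingNorm (traceEncoding (p := p) D a) : ℤ) = #D - #{x ∈ D | Tr (a * x) = 0} := by
  have h1 : hammingNorm (traceEncoding (p := p) D a) = #{x ∈ D | ¬ Tr (a * x) = 0} := by
    rw [hammingNorm]
    refine card_bij (fun d _ => (d : F)) ?_ ?_ ?_
    · intro d hd
      simpa [traceEncoding_apply] using hd
    · intro d _ d' _ h
      exact Subtype.ext h
    · intro x hx
      rw [mem_filter] at hx
      exact ⟨⟨x, hx.1⟩, by simpa [traceEncoding_apply] using hx.2, rfl⟩
  have h2 := card_filter_add_card_filter_not (s := D) (fun x => Tr (a * x) = 0)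
  rw [h1, ← h2]
  push_cast
  ring

theorem quadraticChar_neg_one_one_mod_four (h : p % 4 = 1) : χ (-1) = 1 := by
  have hp : p ≠ 2 := by rintro rfl; omega
  rw [quadraticChar_neg_one (ringChar_zmod_ne_two hp), ZMod.card, ZMod.χ₄_nat_one_mod_four h]

theorem quadraticChar_neg_one_three_mod_four (h : p % 4 = 3) : χ (-1) = -1 := by
  have hp : p ≠ 2 := by rintro rfl; omega
  rw [quadraticChar_neg_one (ringChar_zmod_ne_two hp), ZMod.card, ZMod.χ₄_nat_three_mod_four h]

theorem two_mul_card_sq_add_four_mul (hp : p ≠ 2) (z : ZMod p) :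
    2 * (#{u : ZMod p | χ (u ^ 2 + 4 * z) = χ (-1)} : ℤ)
      = if χ z = 0 then (if χ (-1) = 1 then 2 * ((p : ℤ) - 1) else 0)
        else p - 1 - χ (-1) * χ z - χ (-1) := by
  have hm : (-1 : ZMod p) ≠ 0 := by simp
  have h4 := four_ne_zero_zmod hp
  simp only [quadraticChar_eq_zero_iff]
  split_ifs with hz h
  · simp only [hz, mul_zero, add_zero]
    rw [card_quadraticChar_sq_eq _ (quadraticChar_dichotomy hm), if_pos h, ZMod.card]
  · simp only [hz, mul_zero, add_zero]
    rw [card_quadraticChar_sq_eq _ (quadraticChar_dichotomy hm), if_neg h]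
    rfl
  · rw [two_mul_card_quadraticChar_sq_add (ringChar_zmod_ne_two hp) (mul_ne_zero h4 hz)
      (quadraticChar_dichotomy hm), ZMod.card, ← neg_one_mul, map_mul, map_mul,
      quadraticChar_four (ringChar_zmod_ne_two hp), one_mul]

/-- The row of `tableOneModFour` to which a code word belongs, in terms of the quadratic
characters of its invariants. -/
def rowOneModFour (z : Prop) [Decidable z] (σ τ : ℤ) : Fin 6 :=
  if z then 0 else if σ = 0 then (if τ = 0 then 1 else 5)
  else if σ = 1 then (if τ = 1 then 3 else 2) else (if τ = 1 then 2 else 4)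

/-- The row of `tableThreeModFour` to which a code word belongs, in terms of the quadratic
characters of its invariants. -/
def rowThreeModFour (z : Prop) [Decidable z] (σ τ : ℤ) : Fin 5 :=
  if z then 0 else if σ = 0 then 1
  else if σ = 1 then (if τ = -1 then 2 else 4) else (if τ = -1 then 3 else 2)

variable (hp : p ≠ 2) (hm : Odd m) (hF : Fintype.card F = p ^ (2 * m))
  (hE : ((2 * m : ℕ) : ZMod p) ≠ 0) (hi : legendreSym p ((2 * m : ℕ) : ℤ) = (-1) ^ (i : ℕ))

include hp hm hF hE hi

/-- The weight of a code word. -/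
theorem two_mul_hammingNorm_traceEncoding {w : F} (hw : w ≠ 0) :
    2 * (hammingNorm (traceEncoding (p := p) (definingSet p F i) (w ^ (p ^ 2) + w)) : ℤ)
      = (p - 1) ^ 2 * (p : ℤ) ^ (2 * m - 2) + 2 * (p : ℤ) ^ (m - 1) *
        ((if χ (-1) = 1 then 1 - (p : ℤ) else 0)
          + #{u : ZMod p | χ (u ^ 2 + 4 * (((2 * m : ℕ) : ZMod p) * Q w - (Tr w) ^ 2)) = χ (-1)}
          - (if χ (((2 * m : ℕ) : ZMod p) * Q w) = χ (-1) then 1 else 0)) := by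
  rw [hammingNorm_traceEncoding, mul_sub, two_mul_card_definingSet hp hm hF hE hi,
    two_mul_card_zero_coordinates hp hm hF hE hi hw,
    card_quadraticChar_neg_quadratic (ringChar_zmod_ne_two hp) hE]
  split_ifs <;> ring

theorem weight_rowOneModFour [DecidableEq F] (h1 : p % 4 = 1) (w : F) :
    (hammingNorm (traceEncoding (p := p) (definingSet p F i) (w ^ (p ^ 2) + w)) : ℚ)
      = ((tableOneModFour p (2 * m)).get (rowOneModFour (w = 0)
          (χ (((2 * m : ℕ) : ZMod p) * Q w - (Tr w) ^ 2)) (χ (((2 * m : ℕ) : ZMod p) * Q w)))).1 := by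
  have hp0 : p ^ 2 ≠ 0 := pow_ne_zero _ (Fact.out : p.Prime).ne_zero
  by_cases hw : w = 0
  · subst hw
    simp [rowOneModFour, tableOneModFour, zero_pow hp0]
  have hwt := two_mul_hammingNorm_traceEncoding hp hm hF hE hi hw
  have hT := two_mul_card_sq_add_four_mul hp (((2 * m : ℕ) : ZMod p) * Q w - (Tr w) ^ 2)
  rw [quadraticChar_neg_one_one_mod_four h1] at hwt hT
  -- If σ = 0, then E·Q(w) = Tr(w)² is a square. This rules out (σ, τ) = (0, -1), where the weight
  -- formula would disagree with the assigned row.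
  have hsq : χ (((2 * m : ℕ) : ZMod p) * Q w - (Tr w) ^ 2) = 0 →
      χ (((2 * m : ℕ) : ZMod p) * Q w) ≠ -1 := by
    intro h
    rw [quadraticChar_eq_zero_iff, sub_eq_zero] at h
    rw [h, Ne, quadraticChar_neg_one_iff_not_isSquare, not_not]
    exact IsSquare.sq _
  generalize hT' : (#{u : ZMod p | χ (u ^ 2 + 4 * (((2 * m : ℕ) : ZMod p) * Q w - (Tr w) ^ 2)) = 1} : ℤ)
    = T at hwt hT
  have hσ := quadraticChar_values (((2 * m : ℕ) : ZMod p) * Q w - (Tr w) ^ 2)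
  have hτ := quadraticChar_values (((2 * m : ℕ) : ZMod p) * Q w)
  generalize χ (((2 * m : ℕ) : ZMod p) * Q w - (Tr w) ^ 2) = σ at *
  generalize χ (((2 * m : ℕ) : ZMod p) * Q w) = τ at *
  generalize hammingNorm (traceEncoding (p := p) (definingSet p F i) (w ^ (p ^ 2) + w)) = n at *
  have hwt' := congrArg (Int.cast (R := ℚ)) hwt
  have hT2 : (T : ℚ) = if σ = 0 then (p : ℚ) - 1 else (p - 1 - σ - 1) / 2 := by
    rw [if_pos (rfl : (1 : ℤ) = 1)] at hT
    have hT2 := congrArg (Int.cast (R := ℚ)) hT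
    split_ifs at hT2 ⊢ <;> push_cast at hT2 <;> linarith
  push_cast at hwt'
  generalize (T : ℚ) = t at hwt' hT2
  rcases hσ with rfl | rfl | rfl <;> rcases hτ with rfl | rfl | rfl <;>
    simp [hw, rowOneModFour, tableOneModFour] at hwt' hT2 hsq ⊢ <;>
    linear_combination hwt' / 2 + (p : ℚ) ^ (m - 1) * hT2

theorem weight_rowThreeModFour [DecidableEq F] (h3 : p % 4 = 3) (w : F) :
    (hammingNorm (traceEncoding (p := p) (definingSet p F i) (w ^ (p ^ 2) + w)) : ℚ)
      = ((tableThreeModFour p (2 * m)).get (rowThreeModFour (w = 0)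
          (χ (((2 * m : ℕ) : ZMod p) * Q w - (Tr w) ^ 2)) (χ (((2 * m : ℕ) : ZMod p) * Q w)))).1 := by
  have hp0 : p ^ 2 ≠ 0 := pow_ne_zero _ (Fact.out : p.Prime).ne_zero
  by_cases hw : w = 0
  · subst hw
    simp [rowThreeModFour, tableThreeModFour, zero_pow hp0]
  have hwt := two_mul_hammingNorm_traceEncoding hp hm hF hE hi hw
  have hT := two_mul_card_sq_add_four_mul hp (((2 * m : ℕ) : ZMod p) * Q w - (Tr w) ^ 2)
  rw [quadraticChar_neg_one_three_mod_four h3] at hwt hT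
  have hsq : χ (((2 * m : ℕ) : ZMod p) * Q w - (Tr w) ^ 2) = 0 →
      χ (((2 * m : ℕ) : ZMod p) * Q w) ≠ -1 := by
    intro h
    rw [quadraticChar_eq_zero_iff, sub_eq_zero] at h
    rw [h, Ne, quadraticChar_neg_one_iff_not_isSquare, not_not]
    exact IsSquare.sq _
  generalize hT' : (#{u : ZMod p | χ (u ^ 2 + 4 * (((2 * m : ℕ) : ZMod p) * Q w - (Tr w) ^ 2)) = -1} : ℤ)
    = T at hwt hT
  have hσ := quadraticChar_values (((2 * m : ℕ) : ZMod p) * Q w - (Tr w) ^ 2)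
  have hτ := quadraticChar_values (((2 * m : ℕ) : ZMod p) * Q w)
  generalize χ (((2 * m : ℕ) : ZMod p) * Q w - (Tr w) ^ 2) = σ at *
  generalize χ (((2 * m : ℕ) : ZMod p) * Q w) = τ at *
  generalize hammingNorm (traceEncoding (p := p) (definingSet p F i) (w ^ (p ^ 2) + w)) = n at *
  have hwt' := congrArg (Int.cast (R := ℚ)) hwt
  have hT2 : (T : ℚ) = if σ = 0 then (0 : ℚ) else ((p : ℚ) - 1 + σ + 1) / 2 := by
    rw [if_neg (by norm_num : ¬ (-1 : ℤ) = 1)] at hT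
    have hT2 := congrArg (Int.cast (R := ℚ)) hT
    split_ifs at hT2 ⊢ <;> push_cast at hT2 <;> linarith
  push_cast at hwt'
  generalize (T : ℚ) = t at hwt' hT2
  rcases hσ with rfl | rfl | rfl <;> rcases hτ with rfl | rfl | rfl <;>
    simp [hw, rowThreeModFour, tableThreeModFour] at hwt' hT2 hsq ⊢ <;>
    linear_combination hwt' / 2 + (p : ℚ) ^ (m - 1) * hT2

end WeightDistribution

/-! ### Multiplicities of the rows. -/

section WeightMultiplicities

open Finset QuadraticMap

/-- A pointwise identity between indicators. By `hz` the elements of row 0 all lie in the class (0,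
0), hence the subtraction in row 1. -/
theorem card_rowOneModFour {X : Type*} [Fintype X] (z : X → Prop) [DecidablePred z] (a b : X → ℤ)
    (ha : ∀ x, a x = 0 ∨ a x = 1 ∨ a x = -1) (hb : ∀ x, b x = 0 ∨ b x = 1 ∨ b x = -1)
    (hz : ∀ x, z x → a x = 0 ∧ b x = 0) (j : Fin 6) :
    (#{x | rowOneModFour (z x) (a x) (b x) = j} : ℚ) = ![(#{x | z x} : ℚ),
      #{x | a x = 0 ∧ b x = 0} - #{x | z x},
      #{x | a x = 1 ∧ b x = 0} + #{x | a x = 1 ∧ b x = -1} + #{x | a x = -1 ∧ b x = 1},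
      #{x | a x = 1 ∧ b x = 1},
      #{x | a x = -1 ∧ b x = 0} + #{x | a x = -1 ∧ b x = -1},
      #{x | a x = 0 ∧ b x = 1} + #{x | a x = 0 ∧ b x = -1}] j := by
  simp only [card_filter]
  push_cast
  simp only [← sum_add_distrib, ← sum_sub_distrib]
  fin_cases j <;> refine Finset.sum_congr rfl fun x _ => ?_ <;> by_cases h : z x
  all_goals
    first
    | (have h' := hz x h; simp [rowOneModFour, h, h'.1, h'.2])
    | (rcases ha x with h1 | h1 | h1 <;> rcases hb x with h2 | h2 | h2 <;>
        simp [rowOneModFour, h, h1, h2])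

theorem card_rowThreeModFour {X : Type*} [Fintype X] (z : X → Prop) [DecidablePred z]
    (a b : X → ℤ) (ha : ∀ x, a x = 0 ∨ a x = 1 ∨ a x = -1)
    (hb : ∀ x, b x = 0 ∨ b x = 1 ∨ b x = -1)
    (hz : ∀ x, z x → a x = 0 ∧ b x = 0) (j : Fin 5) :
    (#{x | rowThreeModFour (z x) (a x) (b x) = j} : ℚ) = ![(#{x | z x} : ℚ),
      #{x | a x = 0 ∧ b x = 0} + #{x | a x = 0 ∧ b x = 1} + #{x | a x = 0 ∧ b x = -1}
        - #{x | z x},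
      #{x | a x = 1 ∧ b x = -1} + #{x | a x = -1 ∧ b x = 0} + #{x | a x = -1 ∧ b x = 1},
      #{x | a x = -1 ∧ b x = -1},
      #{x | a x = 1 ∧ b x = 0} + #{x | a x = 1 ∧ b x = 1}] j := by
  simp only [card_filter]
  push_cast
  simp only [← sum_add_distrib, ← sum_sub_distrib]
  fin_cases j <;> refine Finset.sum_congr rfl fun x _ => ?_ <;> by_cases h : z x
  all_goals
    first
    | (have h' := hz x h; simp [rowThreeModFour, h, h'.1, h'.2])
    | (rcases ha x with h1 | h1 | h1 <;> rcases hb x with h2 | h2 | h2 <;>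
        simp [rowThreeModFour, h, h1, h2])

variable {p : ℕ} [Fact p.Prime] {F : Type*} [Field F] [Fintype F] [Algebra (ZMod p) F] {m : ℕ}
  {i : Fin 2}

local notation "χ" => quadraticChar (ZMod p)
local notation "Q" => traceNormForm p F
local notation "Tr" => Algebra.trace (ZMod p) F

variable (hp : p ≠ 2) (hm : Odd m) (hF : Fintype.card F = p ^ (2 * m))
  (hE : ((2 * m : ℕ) : ZMod p) ≠ 0)

include hp hm hF hE

theorem four_mul_card_class {σ τ : ℤ} (hσ : σ = 1 ∨ σ = -1) (hτ : τ = 1 ∨ τ = -1) :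
    4 * (#{y : F | χ (((2 * m : ℕ) : ZMod p) * Q y - (Tr y) ^ 2) = σ
        ∧ χ (((2 * m : ℕ) : ZMod p) * Q y) = τ} : ℚ)
      = (p - 1) * (p - 1 - τ - χ (-1) * σ)
        * ((p : ℚ) ^ (2 * m - 2) - (p : ℚ) ^ (m - 1) * (χ (-1) * σ)) := by
  have h1 := card_quadraticChar_traceNormForm (F := F) hp hm hF hE σ τ
  have h2 := four_mul_card_pairs_quadraticChar (ringChar_zmod_ne_two hp) hσ hτ
  rw [ZMod.card] at h2
  have h3 := congrArg (4 * ·) h1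
  simp only [← mul_assoc (4 : ℤ), h2] at h3
  exact_mod_cast h3

theorem card_class_zero_right {σ : ℤ} (hσ : σ = 1 ∨ σ = -1) :
    (#{y : F | χ (((2 * m : ℕ) : ZMod p) * Q y - (Tr y) ^ 2) = σ
        ∧ χ (((2 * m : ℕ) : ZMod p) * Q y) = 0} : ℚ)
      = (if χ (-1) * σ = 1 then (p : ℚ) - 1 else 0)
        * ((p : ℚ) ^ (2 * m - 2) - (p : ℚ) ^ (m - 1) * (χ (-1) * σ)) := by
  have h1 := card_quadraticChar_traceNormForm (F := F) hp hm hF hE σ 0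
  rw [card_pairs_quadraticChar_zero_right hσ, ZMod.card] at h1
  have h2 := congrArg (Int.cast (R := ℚ)) h1
  push_cast at h2 ⊢
  exact h2

theorem card_class_zero_left {τ : ℤ} (hτ : τ = 1 ∨ τ = -1) :
    (#{y : F | χ (((2 * m : ℕ) : ZMod p) * Q y - (Tr y) ^ 2) = 0
        ∧ χ (((2 * m : ℕ) : ZMod p) * Q y) = τ} : ℚ)
      = (if τ = 1 then (p : ℚ) - 1 else 0) * (p : ℚ) ^ (2 * m - 2) := by
  have h1 := card_quadraticChar_traceNormForm (F := F) hp hm hF hE 0 τ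
  rw [card_pairs_quadraticChar_zero_left, card_quadraticChar_sq_eq _ hτ, ZMod.card, mul_zero,
    mul_zero, sub_zero] at h1
  have h2 := congrArg (Int.cast (R := ℚ)) h1
  push_cast at h2 ⊢
  exact h2

theorem card_class_zero_zero :
    (#{y : F | χ (((2 * m : ℕ) : ZMod p) * Q y - (Tr y) ^ 2) = 0
        ∧ χ (((2 * m : ℕ) : ZMod p) * Q y) = 0} : ℚ) = (p : ℚ) ^ (2 * m - 2) := by
  have h1 := card_quadraticChar_traceNormForm (F := F) hp hm hF hE 0 0
  have h3 : #{s : ZMod p | χ (s ^ 2) = 0} = 1 := by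
    rw [card_eq_one]
    exact ⟨0, by ext s; simp only [mem_filter, mem_univ, true_and, quadraticChar_eq_zero_iff,
      mem_singleton]; exact pow_eq_zero_iff two_ne_zero⟩
  rw [card_pairs_quadraticChar_zero_left, h3, mul_zero, mul_zero, sub_zero, Nat.cast_one,
    one_mul] at h1
  have h2 := congrArg (Int.cast (R := ℚ)) h1
  push_cast at h2 ⊢
  exact h2

theorem multiplicity_rowOneModFour [DecidableEq F] (h1 : p % 4 = 1) (j : Fin 6) :
    (#{w : F | rowOneModFour (w = 0) (χ (((2 * m : ℕ) : ZMod p) * Q w - (Tr w) ^ 2))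
        (χ (((2 * m : ℕ) : ZMod p) * Q w)) = j} : ℚ)
      = ((tableOneModFour p (2 * m)).get j).2 := by
  rw [card_rowOneModFour (fun w : F => w = 0) _ _ (fun _ => quadraticChar_values _)
    (fun _ => quadraticChar_values _) (by rintro w rfl; simp)]
  have hz : #{w : F | w = 0} = 1 := by simp [filter_eq']
  have e : χ (-1) = 1 := quadraticChar_neg_one_one_mod_four h1
  have g00 := card_class_zero_zero hp hm hF hE
  have g01 := card_class_zero_left hp hm hF hE (τ := 1) (Or.inl rfl)
  have g0n := card_class_zero_left hp hm hF hE (τ := -1) (Or.inr rfl)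
  have g10 := card_class_zero_right hp hm hF hE (σ := 1) (Or.inl rfl)
  have gn0 := card_class_zero_right hp hm hF hE (σ := -1) (Or.inr rfl)
  have g11 := four_mul_card_class hp hm hF hE (σ := 1) (τ := 1) (Or.inl rfl) (Or.inl rfl)
  have g1n := four_mul_card_class hp hm hF hE (σ := 1) (τ := -1) (Or.inl rfl) (Or.inr rfl)
  have gn1 := four_mul_card_class hp hm hF hE (σ := -1) (τ := 1) (Or.inr rfl) (Or.inl rfl)
  have gnn := four_mul_card_class hp hm hF hE (σ := -1) (τ := -1) (Or.inr rfl) (Or.inr rfl)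
  generalize ((2 * m : ℕ) : ZMod p) = E at g00 g01 g0n g10 gn0 g11 g1n gn1 gnn ⊢
  rw [e] at g10 gn0 g11 g1n gn1 gnn
  rw [if_pos (by norm_num)] at g01 g10
  rw [if_neg (by norm_num)] at g0n gn0
  have hmm : 2 * m / 2 - 1 = m - 1 := by omega
  push_cast at g10 gn0 g11 g1n gn1 gnn g00 g01 g0n
  rw [hz]
  push_cast
  fin_cases j <;> simp only [tableOneModFour, hmm, Fin.zero_eta, Fin.mk_one, Fin.reduceFinMk,
    Matrix.cons_val, List.get_eq_getElem, Fin.isValue]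
  · simp
  · simp [-quadraticChar_apply, -map_mul]; linear_combination g00
  · simp [-quadraticChar_apply, -map_mul]; linear_combination g10 + g1n / 4 + gn1 / 4
  · simp [-quadraticChar_apply, -map_mul]; linear_combination g11 / 4
  · simp [-quadraticChar_apply, -map_mul]; linear_combination gn0 + gnn / 4
  · simp [-quadraticChar_apply, -map_mul]; linear_combination g01 + g0n

theorem multiplicity_rowThreeModFour [DecidableEq F] (h3 : p % 4 = 3) (j : Fin 5) :
    (#{w : F | rowThreeModFour (w = 0) (χ (((2 * m : ℕ) : ZMod p) * Q w - (Tr w) ^ 2))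
        (χ (((2 * m : ℕ) : ZMod p) * Q w)) = j} : ℚ)
      = ((tableThreeModFour p (2 * m)).get j).2 := by
  rw [card_rowThreeModFour (fun w : F => w = 0) _ _ (fun _ => quadraticChar_values _)
    (fun _ => quadraticChar_values _) (by rintro w rfl; simp)]
  have hz : #{w : F | w = 0} = 1 := by simp [filter_eq']
  have e : χ (-1) = -1 := quadraticChar_neg_one_three_mod_four h3
  have g00 := card_class_zero_zero hp hm hF hE
  have g01 := card_class_zero_left hp hm hF hE (τ := 1) (Or.inl rfl)
  have g0n := card_class_zero_left hp hm hF hE (τ := -1) (Or.inr rfl)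
  have g10 := card_class_zero_right hp hm hF hE (σ := 1) (Or.inl rfl)
  have gn0 := card_class_zero_right hp hm hF hE (σ := -1) (Or.inr rfl)
  have g11 := four_mul_card_class hp hm hF hE (σ := 1) (τ := 1) (Or.inl rfl) (Or.inl rfl)
  have g1n := four_mul_card_class hp hm hF hE (σ := 1) (τ := -1) (Or.inl rfl) (Or.inr rfl)
  have gn1 := four_mul_card_class hp hm hF hE (σ := -1) (τ := 1) (Or.inr rfl) (Or.inl rfl)
  have gnn := four_mul_card_class hp hm hF hE (σ := -1) (τ := -1) (Or.inr rfl) (Or.inr rfl)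
  generalize ((2 * m : ℕ) : ZMod p) = E at g00 g01 g0n g10 gn0 g11 g1n gn1 gnn ⊢
  rw [e] at g10 gn0 g11 g1n gn1 gnn
  rw [if_pos (by norm_num)] at g01 gn0
  rw [if_neg (by norm_num)] at g0n g10
  have hmm : 2 * m / 2 - 1 = m - 1 := by omega
  have hP : (p : ℚ) ^ (2 * m - 1) = p * (p : ℚ) ^ (2 * m - 2) := by
    have := hm.pos
    rw [← pow_succ']; congr 1; omega
  push_cast at g10 gn0 g11 g1n gn1 gnn g00 g01 g0n
  rw [hz]
  push_cast
  fin_cases j <;> simp only [tableThreeModFour, hmm, hP, Fin.zero_eta, Fin.mk_one,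
    Fin.reduceFinMk, Matrix.cons_val, List.get_eq_getElem, Fin.isValue]
  · simp
  · simp [-quadraticChar_apply, -map_mul]; linear_combination g00 + g01 + g0n
  · simp [-quadraticChar_apply, -map_mul]; linear_combination g1n / 4 + gn0 + gn1 / 4
  · simp [-quadraticChar_apply, -map_mul]; linear_combination gnn / 4
  · simp [-quadraticChar_apply, -map_mul]; linear_combination g10 + g11 / 4

end WeightMultiplicities

/-! ### Injectivity of the encoding and the main theorem. -/

section Main

open Finset QuadraticMap

variable {p : ℕ} [Fact p.Prime] {F : Type*} [Field F] [Fintype F] [Algebra (ZMod p) F] {m : ℕ}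
  {i : Fin 2}

/-- A crude lower bound on the weight suffices: dropping the nonnegative count of u leaves a main
term (p-1)² p^(2m-2) that beats the possible negative correction. -/
theorem traceEncoding_ne_zero (hp : p ≠ 2) (hm : Odd m) (hF : Fintype.card F = p ^ (2 * m))
    (hE : ((2 * m : ℕ) : ZMod p) ≠ 0) (hi : legendreSym p ((2 * m : ℕ) : ℤ) = (-1) ^ (i : ℕ))
    {w : F} (hw : w ≠ 0) :
    traceEncoding (p := p) (definingSet p F i) (w ^ (p ^ 2) + w) ≠ 0 := by
  intro h0
  have h := two_mul_hammingNorm_traceEncoding hp hm hF hE hi hw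
  rw [h0, hammingNorm_zero, Nat.cast_zero, mul_zero] at h
  generalize hT : (#{u : ZMod p | quadraticChar (ZMod p) (u ^ 2 + 4 * (((2 * m : ℕ) : ZMod p) *
    traceNormForm p F w - (Algebra.trace (ZMod p) F w) ^ 2)) = quadraticChar (ZMod p) (-1)} : ℤ) = T
    at h
  have hT0 : 0 ≤ T := hT ▸ Int.natCast_nonneg _
  have hp1 : (1 : ℤ) ≤ p := by exact_mod_cast (Fact.out : p.Prime).one_lt.le
  have hR : 0 < (p : ℤ) ^ (m - 1) := by positivity
  have hPR : (p : ℤ) ^ (m - 1) ≤ (p : ℤ) ^ (2 * m - 2) := pow_le_pow_right₀ hp1 (by omega)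
  have hodd := (Fact.out : p.Prime).odd_of_ne_two hp
  have h4 : p % 4 = 1 ∨ p % 4 = 3 := by
    have := Nat.odd_iff.1 hodd; omega
  have hA := mul_le_mul_of_nonneg_left hPR (sq_nonneg ((p : ℤ) - 1))
  rcases h4 with h4 | h4
  · have hp5 : (5 : ℤ) ≤ p := by
      have := (Fact.out : p.Prime).one_lt
      omega
    rw [quadraticChar_neg_one_one_mod_four h4, if_pos rfl] at h
    have hx : -(p : ℤ) ≤ 1 - (p : ℤ) + T - (if quadraticChar (ZMod p) (((2 * m : ℕ) : ZMod p) *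
        traceNormForm p F w) = 1 then 1 else 0) := by split_ifs <;> linarith
    have hB := mul_le_mul_of_nonneg_left hx (by positivity : 0 ≤ 2 * (p : ℤ) ^ (m - 1))
    -- The inequality (p-1)² > 2p fails for p = 3, but here p ≡ 1 mod 4 gives p ≥ 5.
    have hC : 0 < (p : ℤ) ^ (m - 1) * (((p : ℤ) - 1) ^ 2 - 2 * p) := mul_pos hR (by nlinarith)
    linarith
  · have hp3 : (3 : ℤ) ≤ p := by omega
    rw [quadraticChar_neg_one_three_mod_four h4, if_neg (by norm_num : ¬ (-1 : ℤ) = 1)] at h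
    have hx : -1 ≤ 0 + T - (if quadraticChar (ZMod p) (((2 * m : ℕ) : ZMod p) *
        traceNormForm p F w) = -1 then 1 else 0) := by split_ifs <;> linarith
    have hB := mul_le_mul_of_nonneg_left hx (by positivity : 0 ≤ 2 * (p : ℤ) ^ (m - 1))
    have hC : 0 < (p : ℤ) ^ (m - 1) * (((p : ℤ) - 1) ^ 2 - 2) := mul_pos hR (by nlinarith)
    linarith

end Main

theorem theorem5 (p : ℕ) [Fact p.Prime] (hp : p ≠ 2) (e : ℕ) (he : e % 4 = 2)
    (F : Type*) [Field F] [Fintype F] [Algebra (ZMod p) F] (hF : Fintype.card F = p ^ e)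
    (i : Fin 2) (hi : legendreSym p (e : ℤ) = (-1) ^ (i : ℕ)) :
    ((definingSet p F i).card : ℚ) =
        ((p : ℚ) - 1) / 2 * (p : ℚ) ^ (e - 1)
          - (1 + (quadraticChar (ZMod p) (-1) : ℚ) * (p : ℚ)) / 2 * (p : ℚ) ^ (e / 2 - 1) ∧
      Module.finrank (ZMod p) (traceCode p (definingSet p F i)) = e ∧
      ((Finset.Icc 1 (definingSet p F i).card).filter
          (fun w => weightCount (traceCode p (definingSet p F i)) w ≠ 0)).card ≤ 5 ∧
      (p % 4 = 1 → HasWeightTable (traceCode p (definingSet p F i)) (tableOneModFour p e)) ∧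
      (p % 4 = 3 → HasWeightTable (traceCode p (definingSet p F i)) (tableThreeModFour p e)) := by
  classical
  obtain ⟨m, rfl⟩ : ∃ m, e = 2 * m := ⟨e / 2, by omega⟩
  have hm : Odd m := Nat.odd_iff.2 (by omega)
  -- The Legendre symbol equals ±1, so p does not divide e.
  have hE : ((2 * m : ℕ) : ZMod p) ≠ 0 := by
    intro h
    rw [legendreSym, Int.cast_natCast, h, MulChar.map_zero] at hi
    exact pow_ne_zero (i : ℕ) (by norm_num : (-1 : ℤ) ≠ 0) hi.symm
  have h4 : p % 4 = 1 ∨ p % 4 = 3 := by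
    have := Nat.odd_iff.1 ((Fact.out : p.Prime).odd_of_ne_two hp); omega
  set D := Finset.card (definingSet p F i) with hD
  have hinj : Function.Injective (traceEncoding (p := p) (definingSet p F i)) := by
    refine (injective_iff_map_eq_zero _).2 fun a ha => ?_
    obtain ⟨w, rfl⟩ := (pow_sq_char_add_self_bijective hp hm hF).2 a
    by_contra h
    refine traceEncoding_ne_zero hp hm hF hE hi (w := w) ?_ ha
    rintro rfl
    simp [(Fact.out : p.Prime).ne_zero] at h
  have hinj' : Function.Injective
      fun w : F => traceEncoding (p := p) (definingSet p F i) (w ^ (p ^ 2) + w) :=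
    hinj.comp (pow_sq_char_add_self_bijective hp hm hF).1
  have hmem : ∀ c, c ∈ traceCode p (definingSet p F i) ↔
      ∃ w : F, traceEncoding (p := p) (definingSet p F i) (w ^ (p ^ 2) + w) = c := by
    intro c
    rw [← range_traceEncoding, LinearMap.mem_range]
    constructor
    · rintro ⟨a, rfl⟩
      obtain ⟨w, rfl⟩ := (pow_sq_char_add_self_bijective hp hm hF).2 a
      exact ⟨w, rfl⟩
    · rintro ⟨w, rfl⟩; exact ⟨_, rfl⟩
  have t1 : p % 4 = 1 →
      HasWeightTable (traceCode p (definingSet p F i)) (tableOneModFour p (2 * m)) := fun h =>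
    hasWeightTable_ofFn _ _ hinj' hmem (tableOneModFour p (2 * m)).get _
      (weight_rowOneModFour hp hm hF hE hi h) (multiplicity_rowOneModFour hp hm hF hE h)
  have t3 : p % 4 = 3 →
      HasWeightTable (traceCode p (definingSet p F i)) (tableThreeModFour p (2 * m)) := fun h =>
    hasWeightTable_ofFn _ _ hinj' hmem (tableThreeModFour p (2 * m)).get _
      (weight_rowThreeModFour hp hm hF hE hi h) (multiplicity_rowThreeModFour hp hm hF hE h)
  refine ⟨?_, ?_, ?_, t1, t3⟩
  · have h := congrArg (Int.cast (R := ℚ)) (two_mul_card_definingSet hp hm hF hE hi)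
    have hP : (p : ℚ) ^ (2 * m - 1) = p * (p : ℚ) ^ (2 * m - 2) := by
      have := hm.pos
      rw [← pow_succ']; congr 1; omega
    have hmm : 2 * m / 2 - 1 = m - 1 := by omega
    rw [hP, hmm]
    rcases h4 with h4 | h4
    · rw [quadraticChar_neg_one_one_mod_four h4] at h ⊢
      rw [if_pos rfl] at h
      push_cast at h ⊢
      linear_combination h / 2
    · rw [quadraticChar_neg_one_three_mod_four h4] at h ⊢
      rw [if_neg (by norm_num)] at h
      push_cast at h ⊢
      linear_combination h / 2
  · rw [← range_traceEncoding, LinearMap.finrank_range_of_inj hinj, finrank_of_card hF]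
  · rcases h4 with h4 | h4
    · exact (t1 h4).card_weights_le rfl D
    · exact ((t3 h4).card_weights_le rfl D).trans (by simp)
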